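/- Let $n,q,k\ge 1$ be integers, let $\varepsilon,\delta\in(0,1)$, and let $A\in\mathbb{R}^{n\times n}$ be any matrix. Let $S\in\mathbb{R}^{n\times q}$ be a random matrix with independent entries, each distributed as $Z/\sqrt{q}$ with $Z\sim\mathcal N(0,1)$. If $$q\ \ge\ \frac{288\,k}{\varepsilon^{2}\delta},$$ then, with probability at least $1-\delta$, the matrix $AS$ is an $(\varepsilon,0,k)$-projection-cost-preserving sketch of $A$; that is, with probability at least $1-\delta$, the inequalities $$(1-\varepsilon)\,\|A-PA\|_F^2\ \le\ \|AS-PAS\|_F^2\ \le\ (1+\varepsilon)\,\|A-PA\|_F^2$$ hold simultaneously for all orthogonal projection matrices $P\in\mathbb{R}^{n\times n}$ of rank $k$. Here $\|\cdot\|_F$ denotes the Frobenius norm. In general, for $0\le\varepsilon<1$ and $c\ge 0$, a matrix $\tilde A\in\mathbb{R}^{n\times d'}$ is called an $(\varepsilon,c,k)$-projection-cost-preserving sketch of $A\in\mathbb{R}^{n\times d}$ if $(1-\varepsilon)\|A-PA\|_F^2\le\|\tilde A-P\tilde A\|_F^2+c\le(1+\varepsilon)\|A-PA\|_F^2$ for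 all orthogonal projection matrices $P\in\mathbb{R}^{n\times n}$ of rank $k$. -/

import Mathlib

section

open MeasureTheory ProbabilityTheory

open scoped Matrix.Norms.Frobenius in
/-- `B` is an `(ε, c, k)`-projection-cost-preserving sketch of `A`. The norm `‖·‖` is the
Frobenius norm; `P` runs over all orthogonal projection matrices of rank exactly `k`
(real, symmetric, idempotent), and `c` does not depend on `P`. -/
def IsPCPS {n d d' : ℕ} (ε c : ℝ) (k : ℕ)
    (A : Matrix (Fin n) (Fin d) ℝ) (B : Matrix (Fin n) (Fin d') ℝ) : Prop :=
  0 ≤ ε ∧ ε < 1 ∧ 0 ≤ c ∧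
    ∀ P : Matrix (Fin n) (Fin n) ℝ, P.IsSymm → IsIdempotentElem P → P.rank = k →
      (1 - ε) * ‖A - P * A‖ ^ 2 ≤ ‖B - P * B‖ ^ 2 + c ∧
        ‖B - P * B‖ ^ 2 + c ≤ (1 + ε) * ‖A - P * A‖ ^ 2

/-- `S` is a random `n × q` matrix whose entries are jointly independent, each one distributed
as `Z / √q` with `Z` a standard normal random variable. -/
structure IsScaledGaussianMatrix {Ω : Type*} [MeasurableSpace Ω] (μ : Measure Ω) {n q : ℕ}
    (S : Ω → Matrix (Fin n) (Fin q) ℝ) : Prop where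
  indep : iIndepFun (fun (p : Fin n × Fin q) (ω : Ω) => S ω p.1 p.2) μ
  law : ∀ (i : Fin n) (j : Fin q),
    HasLaw (fun ω => S ω i j) ((gaussianReal 0 1).map (fun z : ℝ => z / √(q : ℝ))) μ

end

open Matrix MeasureTheory ProbabilityTheory
open scoped NNReal InnerProductSpace

/-! Let `V` be an orthogonal matrix diagonalising `Aᵀ * A`, let `B = A * V`, so that `Bᵀ * B =
diagonal l`, and let `W = Vᵀ * (S * Sᵀ - 1) * V`. With `C = (1 - P) * B` the cost of `A` is `T = tr
(C Cᵀ)`, and the cost of the sketch differs from it by `tr (C W Cᵀ)`. The goal is thus `|tr (C W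
Cᵀ)| ≤ ε T`, for all `P` at once.

Let `K` index the `k` largest `l a` and let `τ` be the sum of the others. A projection of rank `k`
captures at most the `k` largest values, so `τ ≤ T` (`sum_compl_le_trace_of_rank`). Split `W` along
`K` and its complement. If the head block has quadratic form at most `ε / 2` in absolute value, it
contributes at most `ε / 2 * T`. The other blocks are handled by Cauchy–Schwarz, which separates `P`
from `W`: what remains of `P` is `T`, `τ` or `tr P = k`, and what remains of `W` is a weighted sum
of squared entries (`abs_trace_mul_mul_transpose_le`). No union bound over `P` is needed.

Two random events remain. The head form is small with high probability by a net of at most `5 ^ k`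
points and a Chernoff bound (`measureReal_not_subspace_embedding`). The weighted sums are small by
Markov's inequality, because each entry of `W` has second moment at most `2 / q`
(`measureReal_tail_le`). The failure probabilities are at most `5 / 9 * δ` and `4 / 9 * δ`. -/

/-! ### Deterministic part: projections, spectral tails and the block estimate. -/

theorem Matrix.trace_eq_rank_of_isIdempotentElem {ι : Type*} [Fintype ι] [DecidableEq ι]
    {P : Matrix ι ι ℝ} (hP : IsIdempotentElem P) : P.trace = P.rank := by
  have h : IsIdempotentElem P.toLin' := by
    rw [IsIdempotentElem, Module.End.mul_eq_comp, ← Matrix.toLin'_mul, hP.eq]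
  have := (LinearMap.IsIdempotentElem.isProj_range _ h).trace
  rw [Matrix.trace_toLin'_eq] at this
  rw [this, Matrix.rank, Matrix.toLin'_apply']

/-- A finite family of reals has a subfamily of any admissible size dominating the rest. -/
theorem exists_card_eq_forall_le {ι : Type*} [Fintype ι] [DecidableEq ι] (f : ι → ℝ) {k : ℕ}
    (hk : k ≤ Fintype.card ι) :
    ∃ K : Finset ι, K.card = k ∧ ∀ a ∈ K, ∀ b ∉ K, f b ≤ f a := by
  induction k with
  | zero => exact ⟨∅, by simp⟩
  | succ k ih =>
    obtain ⟨K, hK, h⟩ := ih (by omega)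
    have hne : Kᶜ.Nonempty := by
      rw [← Finset.card_pos, Finset.card_compl]; omega
    obtain ⟨m, hm, hmax⟩ := Finset.exists_max_image Kᶜ f hne
    rw [Finset.mem_compl] at hm
    refine ⟨insert m K, by rw [Finset.card_insert_of_notMem hm, hK], ?_⟩
    intro a ha b hb
    rw [Finset.mem_insert, not_or] at hb
    rcases Finset.mem_insert.1 ha with rfl | ha
    · exact hmax b (by simpa using hb.2)
    · exact h a ha b hb.2

/-- Weights in `[0, 1]` of total mass at most `k` give at most the sum of the `k` largest values. -/
theorem sum_mul_le_sum_of_dominating {ι : Type*} [Fintype ι] [DecidableEq ι] {f w : ι → ℝ}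
    {K : Finset ι} (hf : ∀ a, 0 ≤ f a) (hK : ∀ a ∈ K, ∀ b ∉ K, f b ≤ f a)
    (hw0 : ∀ a, 0 ≤ w a) (hw1 : ∀ a, w a ≤ 1) (hw : ∑ a, w a ≤ K.card) :
    ∑ a, f a * w a ≤ ∑ a ∈ K, f a := by
  -- The threshold `θ` is the least value of `f` on `K`; mass moved from outside `K` to inside gains
  -- at least `θ` per unit. For `K = ∅` the mass bound forces `w = 0`, and `θ = 0` serves.
  obtain ⟨θ, hθ0, hθ1, hθ2⟩ : ∃ θ : ℝ, 0 ≤ θ ∧ (∀ a ∈ K, θ ≤ f a) ∧ ∀ b ∉ K, f b * w b ≤ θ * w b := by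
    rcases K.eq_empty_or_nonempty with rfl | hne
    · refine ⟨0, le_rfl, by simp, fun b _ => ?_⟩
      have h0 : w b = 0 := by
        refine le_antisymm ?_ (hw0 b)
        refine (Finset.single_le_sum (fun a _ => hw0 a) (Finset.mem_univ b)).trans ?_
        simpa using hw
      simp [h0]
    · obtain ⟨m, hm, hmin⟩ := Finset.exists_min_image K f hne
      exact ⟨f m, hf m, hmin, fun b hb => mul_le_mul_of_nonneg_right (hK m hm b hb) (hw0 b)⟩
  have h1 : ∑ a ∈ K, f a * w a ≤ ∑ a ∈ K, (f a - θ + θ * w a) :=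
    Finset.sum_le_sum fun a ha => by nlinarith [hθ1 a ha, hw1 a]
  have h2 : ∑ a ∈ Kᶜ, f a * w a ≤ ∑ a ∈ Kᶜ, θ * w a :=
    Finset.sum_le_sum fun a ha => hθ2 a (by simpa using ha)
  have h3 := Finset.sum_add_sum_compl K fun a => f a * w a
  have h4 := Finset.sum_add_sum_compl K w
  rw [Finset.sum_add_distrib, Finset.sum_sub_distrib, ← Finset.mul_sum, Finset.sum_const,
    nsmul_eq_mul] at h1
  rw [← Finset.mul_sum] at h2
  nlinarith [mul_le_mul_of_nonneg_left hw hθ0]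


section FrobeniusNorm

open scoped Matrix.Norms.Frobenius

theorem Matrix.frobenius_norm_sq_eq_trace {m n : Type*} [Fintype m] [Fintype n]
    (M : Matrix m n ℝ) : ‖M‖ ^ 2 = (M * Mᵀ).trace := by
  rw [Matrix.frobenius_norm_def, ← Real.sqrt_eq_rpow, Real.sq_sqrt (by positivity)]
  simp [Matrix.trace, Matrix.mul_apply, pow_two]

end FrobeniusNorm

theorem Matrix.trace_mul_transpose_self_nonneg {m n : Type*} [Fintype m] [Fintype n]
    (M : Matrix m n ℝ) : 0 ≤ (M * Mᵀ).trace := by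
  simp only [Matrix.trace, Matrix.diag, Matrix.mul_apply, Matrix.transpose_apply]
  exact Finset.sum_nonneg fun _ _ => Finset.sum_nonneg fun _ _ => mul_self_nonneg _

/-- The difference `tr (P (1 - Q))` is the squared Frobenius norm of `P * (1 - Q)`. -/
theorem Matrix.trace_mul_le_trace_of_isIdempotentElem {m : Type*} [Fintype m] [DecidableEq m]
    {P Q : Matrix m m ℝ} (hPs : Pᵀ = P)
    (hP : P * P = P) (hQs : Qᵀ = Q) (hQ : Q * Q = Q) : (P * Q).trace ≤ P.trace := by
  have h := (P * (1 - Q)).trace_mul_transpose_self_nonneg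
  have e : (1 - Q) * (1 - Q) = 1 - Q := by
    rw [mul_sub, sub_mul, sub_mul, hQ]; simp
  rw [transpose_mul, transpose_sub, transpose_one, hPs, hQs, Matrix.mul_assoc, ← Matrix.mul_assoc (1 - Q), e,
    trace_mul_comm, Matrix.mul_assoc, hP, trace_mul_comm, mul_sub, mul_one, trace_sub] at h
  linarith

theorem Matrix.transpose_mul_self_apply_self_nonneg {m ι : Type*} [Fintype m] (C : Matrix m ι ℝ) (a : ι) :
    0 ≤ (Cᵀ * C) a a := by
  rw [Matrix.mul_apply]; exact Finset.sum_nonneg fun _ _ => mul_self_nonneg _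

/-- Projecting away `k` dimensions leaves at least the tail of the squared singular values. -/
theorem sum_compl_le_trace_of_rank {m ι : Type*} [Fintype m] [DecidableEq m] [Fintype ι]
    [DecidableEq ι] {B : Matrix m ι ℝ} {l : ι → ℝ} (hB : Bᵀ * B = diagonal l)
    {K : Finset ι} (hK : ∀ a ∈ K, ∀ b ∉ K, l b ≤ l a) {P : Matrix m m ℝ}
    (hPs : Pᵀ = P) (hP : P * P = P) (hPk : P.trace ≤ K.card) :
    ∑ a ∈ Kᶜ, l a ≤ ((((1 - P) * B)ᵀ) * ((1 - P) * B)).trace := by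
  have hY : (1 - P) * (1 - P) = 1 - P := by
    rw [mul_sub, sub_mul, sub_mul, hP]; simp
  have hYs : (1 - P)ᵀ = 1 - P := by rw [transpose_sub, hPs, transpose_one]
  have hl : ∀ a, 0 ≤ l a := fun a => by
    have := B.transpose_mul_self_apply_self_nonneg a
    rwa [hB, diagonal_apply_eq] at this
  have hPB : ((P * B)ᵀ * (P * B)) = Bᵀ * P * B := by
    rw [transpose_mul, hPs, Matrix.mul_assoc, ← Matrix.mul_assoc P P, hP, Matrix.mul_assoc]
  have hYB : (((1 - P) * B)ᵀ * ((1 - P) * B)) = diagonal l - Bᵀ * P * B := by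
    rw [transpose_mul, hYs, Matrix.mul_assoc, ← Matrix.mul_assoc (1 - P) (1 - P), hY, Matrix.sub_mul,
      Matrix.mul_sub, Matrix.one_mul, hB, Matrix.mul_assoc]
  have hp0 : ∀ a, 0 ≤ (Bᵀ * P * B) a a := fun a => by
    rw [← hPB]; exact transpose_mul_self_apply_self_nonneg _ a
  have hp1 : ∀ a, (Bᵀ * P * B) a a ≤ l a := fun a => by
    have := ((1 - P) * B).transpose_mul_self_apply_self_nonneg a
    rw [hYB, Matrix.sub_apply, diagonal_apply_eq] at this
    linarith
  -- The weights `(BᵀPB) a a / l a` sum to `tr (P Q)` for `Q = B * diagonal l⁻¹ * Bᵀ`. Because `0⁻¹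
  -- = 0`, this `Q` is an orthogonal projection even when some `l a` vanish.
  have hQ : ∑ a, (l a)⁻¹ * (Bᵀ * P * B) a a ≤ K.card := by
    refine le_trans ?_ hPk
    have := trace_mul_le_trace_of_isIdempotentElem (P := P) (Q := B * diagonal (fun a => (l a)⁻¹) * Bᵀ)
      hPs hP (by rw [transpose_mul, transpose_mul, transpose_transpose, diagonal_transpose, Matrix.mul_assoc])
      (by
        have : diagonal (fun a => (l a)⁻¹) * Bᵀ * (B * diagonal (fun a => (l a)⁻¹))
            = diagonal (fun a => (l a)⁻¹) := by
          rw [Matrix.mul_assoc, ← Matrix.mul_assoc Bᵀ, hB, diagonal_mul_diagonal, diagonal_mul_diagonal]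
          congr 1; ext a
          by_cases h : l a = 0
          · simp [h]
          · field_simp
        calc _ = B * (diagonal (fun a => (l a)⁻¹) * Bᵀ * (B * diagonal (fun a => (l a)⁻¹))) * Bᵀ := by
              simp only [Matrix.mul_assoc]
          _ = _ := by rw [this])
    refine le_trans (le_of_eq ?_) this
    rw [← Matrix.mul_assoc, trace_mul_comm, ← Matrix.mul_assoc, ← Matrix.mul_assoc, trace_mul_comm]
    simp only [trace, diag, diagonal_mul]
  have hw := sum_mul_le_sum_of_dominating hl hK (w := fun a => (l a)⁻¹ * (Bᵀ * P * B) a a)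
    (fun a => mul_nonneg (inv_nonneg.2 (hl a)) (hp0 a))
    (fun a => by
      rcases (hl a).eq_or_lt with h | h
      · simp [← h]
      · rw [inv_mul_le_iff₀ h]; simpa using hp1 a) hQ
  have he : ∀ a, l a * ((l a)⁻¹ * (Bᵀ * P * B) a a) = (Bᵀ * P * B) a a := fun a => by
    rcases (hl a).eq_or_lt with h | h
    · have := hp0 a; have := hp1 a
      have : (Bᵀ * P * B) a a = 0 := by linarith
      simp [this]
    · field_simp
  simp only [he] at hw
  have hs := Finset.sum_add_sum_compl K l
  rw [hYB, trace_sub, trace_diagonal]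
  simp only [trace, diag]
  linarith

/-- Pythagoras: the columns of `B` are orthogonal with squared lengths `l`. -/
theorem sum_sq_sum_mul_of_transpose_mul_self {m ι : Type*} [Fintype m] [DecidableEq ι]
    {B : Matrix m ι ℝ} {l : ι → ℝ}
    (hB : Bᵀ * B = diagonal l) (s : Finset ι) (c : ι → ℝ) :
    ∑ i, (∑ b ∈ s, c b * B i b) ^ 2 = ∑ b ∈ s, c b ^ 2 * l b := by
  have h : ∀ a b, ∑ i, B i a * B i b = diagonal l a b := fun a b => by
    rw [← hB, Matrix.mul_apply]; rfl
  calc ∑ i, (∑ b ∈ s, c b * B i b) ^ 2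
      = ∑ i, ∑ a ∈ s, ∑ b ∈ s, c a * c b * (B i a * B i b) := by
        refine Finset.sum_congr rfl fun i _ => ?_
        rw [pow_two, Finset.sum_mul_sum]
        exact Finset.sum_congr rfl fun a _ => Finset.sum_congr rfl fun b _ => by ring
    _ = ∑ a ∈ s, ∑ b ∈ s, c a * c b * diagonal l a b := by
        rw [Finset.sum_comm]
        refine Finset.sum_congr rfl fun a _ => ?_
        rw [Finset.sum_comm]
        refine Finset.sum_congr rfl fun b _ => ?_
        rw [← Finset.mul_sum, h]
    _ = _ := by
        refine Finset.sum_congr rfl fun a ha => ?_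
        rw [Finset.sum_eq_single_of_mem a ha fun b _ hb => by
          rw [diagonal_apply_ne _ hb.symm, mul_zero], diagonal_apply_eq]
        ring

/-- Cauchy–Schwarz on pairs of row indices, against the entries of `P`, whose squares sum to `tr P`.
The other factor is evaluated by using the orthogonality of the columns of `B` twice. The price is
the rank of `P`, not the size of `s`. -/
theorem sq_sum_mul_conj_le_trace_mul {m ι : Type*} [Fintype m] [DecidableEq ι]
    {B : Matrix m ι ℝ} {l : ι → ℝ} (hB : Bᵀ * B = diagonal l) (W : Matrix ι ι ℝ) {P : Matrix m m ℝ}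
    (hPs : Pᵀ = P) (hP : P * P = P) (s : Finset ι) :
    (∑ a ∈ s, ∑ b ∈ s, W a b * (Bᵀ * P * B) a b) ^ 2
      ≤ P.trace * ∑ a ∈ s, ∑ b ∈ s, l a * l b * W a b ^ 2 := by
  have hPP : ∑ p : m × m, P p.1 p.2 ^ 2 = P.trace := by
    rw [Fintype.sum_prod_type]
    nth_rw 2 [← hP]
    nth_rw 3 [← hPs]
    simp only [trace, diag, Matrix.mul_apply, transpose_apply, pow_two]
  have e : ∑ a ∈ s, ∑ b ∈ s, W a b * (Bᵀ * P * B) a b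
      = ∑ p : m × m, P p.1 p.2 * ∑ b ∈ s, (∑ a ∈ s, W a b * B p.1 a) * B p.2 b := by
    rw [Fintype.sum_prod_type]
    simp only [Matrix.mul_apply, Finset.mul_sum, Finset.sum_mul, transpose_apply]
    calc ∑ a ∈ s, ∑ b ∈ s, ∑ j, ∑ i, W a b * (B i a * P i j * B j b)
        = ∑ b ∈ s, ∑ a ∈ s, ∑ j, ∑ i, W a b * (B i a * P i j * B j b) := Finset.sum_comm
      _ = ∑ b ∈ s, ∑ j, ∑ i, ∑ a ∈ s, W a b * (B i a * P i j * B j b) := by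
        refine Finset.sum_congr rfl fun b _ => ?_
        rw [Finset.sum_comm]
        exact Finset.sum_congr rfl fun j _ => Finset.sum_comm
      _ = ∑ j, ∑ i, ∑ b ∈ s, ∑ a ∈ s, W a b * (B i a * P i j * B j b) := by
        rw [Finset.sum_comm]
        exact Finset.sum_congr rfl fun j _ => Finset.sum_comm
      _ = ∑ i, ∑ j, ∑ b ∈ s, ∑ a ∈ s, W a b * (B i a * P i j * B j b) := Finset.sum_comm
      _ = _ := Finset.sum_congr rfl fun i _ => Finset.sum_congr rfl fun j _ =>
          Finset.sum_congr rfl fun b _ => Finset.sum_congr rfl fun a _ => by ring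
  rw [e]
  refine (Finset.sum_mul_sq_le_sq_mul_sq _ _ _).trans ?_
  rw [hPP]
  have hP0 : 0 ≤ P.trace := hPP ▸ Finset.sum_nonneg fun _ _ => sq_nonneg _
  refine mul_le_mul_of_nonneg_left (le_of_eq ?_) hP0
  rw [Fintype.sum_prod_type]
  simp only [sum_sq_sum_mul_of_transpose_mul_self hB]
  rw [Finset.sum_comm]
  simp only [← Finset.sum_mul, sum_sq_sum_mul_of_transpose_mul_self hB]
  conv_rhs => rw [Finset.sum_comm]
  refine Finset.sum_congr rfl fun b _ => ?_
  rw [Finset.sum_mul]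
  exact Finset.sum_congr rfl fun a _ => by ring

set_option maxHeartbeats 400000 in
/-- The error of a sketch in the basis of right singular vectors, bounded by the quadratic form
on the leading coordinates and by three weighted sums of squares of the remaining entries. -/
theorem abs_trace_mul_mul_transpose_le {m ι : Type*} [Fintype m] [DecidableEq m] [Fintype ι]
    [DecidableEq ι] {B : Matrix m ι ℝ} {l : ι → ℝ} (hB : Bᵀ * B = diagonal l)
    {W : Matrix ι ι ℝ} (hW : Wᵀ = W) {K : Finset ι} (hK : ∀ a ∈ K, ∀ b ∉ K, l b ≤ l a)
    {P : Matrix m m ℝ} (hPs : Pᵀ = P) (hP : P * P = P) (hPk : P.trace = K.card)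
    {ε : ℝ} (hε : 0 < ε)
    (hhead : ∀ z : ι → ℝ, |∑ a ∈ K, ∑ b ∈ K, z a * W a b * z b| ≤ ε / 2 * ∑ a ∈ K, z a ^ 2)
    (htail : 2 * (∑ a ∈ Kᶜ, l a) * (∑ a ∈ K, ∑ b ∈ Kᶜ, W a b ^ 2 * l b)
        + (∑ a ∈ Kᶜ, l a) * (∑ a ∈ Kᶜ, l a * W a a ^ 2)
        + K.card * (∑ a ∈ Kᶜ, ∑ b ∈ Kᶜ, l a * l b * W a b ^ 2)
      ≤ ε ^ 2 / 16 * (∑ a ∈ Kᶜ, l a) ^ 2) :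
    |((1 - P) * B * W * ((1 - P) * B)ᵀ).trace|
      ≤ ε * (((1 - P) * B) * ((1 - P) * B)ᵀ).trace := by
  have hl : ∀ a, 0 ≤ l a := fun a => by
    have := B.transpose_mul_self_apply_self_nonneg a
    rwa [hB, diagonal_apply_eq] at this
  have hτT := sum_compl_le_trace_of_rank hB hK hPs hP hPk.le
  have hτ0 : 0 ≤ ∑ a ∈ Kᶜ, l a := Finset.sum_nonneg fun a _ => hl a
  set C := (1 - P) * B with hC
  rw [trace_mul_comm C Cᵀ]
  set T := (Cᵀ * C).trace with hT
  set τ := ∑ a ∈ Kᶜ, l a with hτ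
  have hCC : Cᵀ * C = Cᵀ * B := by
    have hY : (1 - P) * (1 - P) = 1 - P := by
      rw [mul_sub, sub_mul, sub_mul, hP]; simp
    rw [hC, transpose_mul, transpose_sub, transpose_one, hPs, Matrix.mul_assoc,
      ← Matrix.mul_assoc (1 - P) (1 - P), hY, Matrix.mul_assoc]
  have hCP : Cᵀ * C = diagonal l - Bᵀ * P * B := by
    rw [hCC, hC, transpose_mul, transpose_sub, transpose_one, hPs, Matrix.mul_sub, Matrix.sub_mul,
      Matrix.mul_one, hB]
  have hG : ∀ a b, (Cᵀ * C) a b = (Cᵀ * C) b a := fun a b => by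
    simp only [Matrix.mul_apply, transpose_apply, mul_comm]
  have hWs : ∀ a b, W a b = W b a := fun a b => by
    conv_lhs => rw [← hW, transpose_apply]
  have htr : (C * W * Cᵀ).trace = ∑ a, ∑ b, W a b * (Cᵀ * C) a b := by
    rw [Matrix.mul_assoc, trace_mul_comm, Matrix.mul_assoc, trace]
    refine Finset.sum_congr rfl fun a _ => ?_
    rw [diag, Matrix.mul_apply]
    exact Finset.sum_congr rfl fun b _ => by rw [hG a b]
  have hcol : ∀ s : Finset ι, ∑ a ∈ s, ∑ i, C i a ^ 2 ≤ T := fun s => by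
    have : ∀ a, ∑ i, C i a ^ 2 = (Cᵀ * C) a a := fun a => by
      simp [Matrix.mul_apply, pow_two]
    simp only [this, hT, trace, diag]
    exact Finset.sum_le_sum_of_subset_of_nonneg (Finset.subset_univ _)
      fun a _ _ => transpose_mul_self_apply_self_nonneg C a
  have hsplit : (C * W * Cᵀ).trace = ∑ a ∈ K, ∑ b ∈ K, W a b * (Cᵀ * C) a b
      + 2 * ∑ a ∈ K, ∑ b ∈ Kᶜ, W a b * (Cᵀ * C) a b
      + ∑ a ∈ Kᶜ, ∑ b ∈ Kᶜ, W a b * (Cᵀ * C) a b := by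
    have h1 : ∑ a ∈ Kᶜ, ∑ b ∈ K, W a b * (Cᵀ * C) a b
        = ∑ a ∈ K, ∑ b ∈ Kᶜ, W a b * (Cᵀ * C) a b := by
      rw [Finset.sum_comm]
      exact Finset.sum_congr rfl fun a _ => Finset.sum_congr rfl fun b _ => by rw [hG, hWs]
    have h2 : ∀ a, ∑ b, W a b * (Cᵀ * C) a b
        = ∑ b ∈ K, W a b * (Cᵀ * C) a b + ∑ b ∈ Kᶜ, W a b * (Cᵀ * C) a b := fun a =>
      (Finset.sum_add_sum_compl K _).symm
    rw [htr, ← Finset.sum_add_sum_compl K]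
    simp only [h2, Finset.sum_add_distrib]
    rw [h1]; ring
  have hH : |∑ a ∈ K, ∑ b ∈ K, W a b * (Cᵀ * C) a b| ≤ ε / 2 * T := by
    have e : ∑ a ∈ K, ∑ b ∈ K, W a b * (Cᵀ * C) a b
        = ∑ i, ∑ a ∈ K, ∑ b ∈ K, C i a * W a b * C i b := by
      symm
      rw [Finset.sum_comm]
      refine Finset.sum_congr rfl fun a _ => ?_
      rw [Finset.sum_comm]
      refine Finset.sum_congr rfl fun b _ => ?_
      rw [Matrix.mul_apply, Finset.mul_sum]
      exact Finset.sum_congr rfl fun i _ => by rw [transpose_apply]; ring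
    rw [e]
    calc _ ≤ ∑ i, |∑ a ∈ K, ∑ b ∈ K, C i a * W a b * C i b| := Finset.abs_sum_le_sum_abs _ _
      _ ≤ ∑ i, ε / 2 * ∑ a ∈ K, C i a ^ 2 := Finset.sum_le_sum fun i _ => hhead (C i)
      _ = ε / 2 * ∑ a ∈ K, ∑ i, C i a ^ 2 := by rw [← Finset.mul_sum, Finset.sum_comm]
      _ ≤ _ := mul_le_mul_of_nonneg_left (hcol K) (by positivity)
  set X := ∑ a ∈ K, ∑ b ∈ Kᶜ, W a b * (Cᵀ * C) a b with hX
  set R₁ := ∑ a ∈ K, ∑ b ∈ Kᶜ, W a b ^ 2 * l b with hR₁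
  set R₂ := ∑ a ∈ Kᶜ, l a * W a a ^ 2 with hR₂
  set R₃ := ∑ a ∈ Kᶜ, ∑ b ∈ Kᶜ, l a * l b * W a b ^ 2 with hR₃
  have hR₁0 : 0 ≤ R₁ := Finset.sum_nonneg fun a _ => Finset.sum_nonneg fun b _ =>
    mul_nonneg (sq_nonneg _) (hl b)
  have hR₂0 : 0 ≤ R₂ := Finset.sum_nonneg fun a _ => mul_nonneg (hl a) (sq_nonneg _)
  have hR₃0 : 0 ≤ R₃ := Finset.sum_nonneg fun a _ => Finset.sum_nonneg fun b _ =>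
    mul_nonneg (mul_nonneg (hl a) (hl b)) (sq_nonneg _)
  -- Writing `Cᵀ * C` as `Cᵀ * B` puts the tail index on `B`, whose columns are orthogonal, so the
  -- second Cauchy–Schwarz factor is exactly `R₁`.
  have hX2 : X ^ 2 ≤ T * R₁ := by
    have e : X = ∑ p ∈ K ×ˢ (Finset.univ : Finset m), C p.2 p.1 * ∑ b ∈ Kᶜ, W p.1 b * B p.2 b := by
      rw [hX, hCC, Finset.sum_product]
      refine Finset.sum_congr rfl fun a _ => ?_
      simp only [Finset.mul_sum]
      rw [Finset.sum_comm]
      refine Finset.sum_congr rfl fun b _ => ?_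
      rw [Matrix.mul_apply, Finset.mul_sum]
      exact Finset.sum_congr rfl fun i _ => by rw [transpose_apply]; ring
    rw [e]
    refine (Finset.sum_mul_sq_le_sq_mul_sq _ _ _).trans ?_
    rw [Finset.sum_product, Finset.sum_product]
    refine mul_le_mul (hcol K) (le_of_eq ?_) (by positivity) (hτ0.trans hτT)
    exact Finset.sum_congr rfl fun a _ =>
      sum_sq_sum_mul_of_transpose_mul_self hB Kᶜ fun b => W a b
  -- On the tail block `Cᵀ * C = diagonal l - Bᵀ * P * B`: `Y` is the diagonal part, `Z` the part of
  -- rank at most `k`.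
  obtain ⟨Y, Z, hYZ, hY2, hZ2⟩ : ∃ Y Z : ℝ, ∑ a ∈ Kᶜ, ∑ b ∈ Kᶜ, W a b * (Cᵀ * C) a b = Y - Z ∧
      Y ^ 2 ≤ τ * R₂ ∧ Z ^ 2 ≤ K.card * R₃ := by
    refine ⟨∑ a ∈ Kᶜ, l a * W a a, ∑ a ∈ Kᶜ, ∑ b ∈ Kᶜ, W a b * (Bᵀ * P * B) a b, ?_, ?_, ?_⟩
    · rw [← Finset.sum_sub_distrib]
      refine Finset.sum_congr rfl fun a ha => ?_
      simp only [hCP, Matrix.sub_apply, mul_sub, Finset.sum_sub_distrib]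
      rw [Finset.sum_eq_single_of_mem a ha fun b _ hb => by
        rw [diagonal_apply_ne _ hb.symm, mul_zero], diagonal_apply_eq, mul_comm]
    · exact Finset.sum_sq_le_sum_mul_sum_of_sq_le_mul Kᶜ (r := fun a => l a * W a a)
        (f := l) (g := fun a => l a * W a a ^ 2) (fun a _ => hl a)
        (fun a _ => mul_nonneg (hl a) (sq_nonneg _)) (fun a _ => le_of_eq (by ring))
    · rw [← hPk]; exact sq_sum_mul_conj_le_trace_mul hB W hPs hP Kᶜ
  have hXYZ : |2 * X + (Y - Z)| ≤ ε / 2 * T := by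
    have hT0 : 0 ≤ T := hτ0.trans hτT
    refine abs_le_of_sq_le_sq ?_ (by positivity)
    -- Cauchy–Schwarz for the four summands `X, X, Y, -Z`; the factor `4` turns `ε ^ 2 / 16` into
    -- `(ε / 2) ^ 2`.
    have h1 : (2 * X + (Y - Z)) ^ 2 ≤ 4 * (2 * X ^ 2 + Y ^ 2 + Z ^ 2) := by
      nlinarith [sq_nonneg (X - Y), sq_nonneg (X + Z), sq_nonneg (Y + Z)]
    rcases hτ0.eq_or_lt with h0 | h0
    · have hl0 : ∀ b ∈ Kᶜ, l b = 0 :=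
        (Finset.sum_eq_zero_iff_of_nonneg fun a _ => hl a).1 (hτ.symm.trans h0.symm)
      have e1 : R₁ = 0 := Finset.sum_eq_zero fun a _ => Finset.sum_eq_zero fun b hb => by
        rw [hl0 b hb, mul_zero]
      have e3 : R₃ = 0 := Finset.sum_eq_zero fun a ha => Finset.sum_eq_zero fun b _ => by
        rw [hl0 a ha, zero_mul, zero_mul]
      rw [e1, mul_zero] at hX2
      rw [e3, mul_zero] at hZ2
      rw [← h0, zero_mul] at hY2
      nlinarith [sq_nonneg (ε / 2 * T)]
    -- Only the cross term carries the factor `T`; `τ ≤ T` makes the three terms homogeneous, so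
    -- that `htail`, which does not involve `P`, applies.
    · have h2 : τ * (2 * T * R₁ + τ * R₂ + K.card * R₃)
          ≤ T * (2 * τ * R₁ + τ * R₂ + K.card * R₃) := by
        have : 0 ≤ (T - τ) * (τ * R₂ + K.card * R₃) :=
          mul_nonneg (by linarith) (by positivity)
        nlinarith
      have h3 : τ * (2 * T * R₁ + τ * R₂ + K.card * R₃) ≤ τ * (ε ^ 2 / 16 * T ^ 2) := by
        refine h2.trans ((mul_le_mul_of_nonneg_left htail (hτ0.trans hτT)).trans ?_)
        have : 0 ≤ ε ^ 2 / 16 * τ * T * (T - τ) :=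
          mul_nonneg (by have := hτ0.trans hτT; positivity) (by linarith)
        nlinarith
      have h4 := le_of_mul_le_mul_left h3 h0
      nlinarith
  rw [hsplit, hYZ, add_assoc]
  refine (abs_add_le _ _).trans ?_
  linarith

/-! ### Nets on the sphere and quadratic forms. -/

/-- The unit sphere of a `d`-dimensional space has a `1/2`-net with at most `5 ^ d` points. -/
theorem exists_half_net_sphere (E : Type*) [NormedAddCommGroup E] [NormedSpace ℝ E]
    [FiniteDimensional ℝ E] :
    ∃ N : Finset E, (∀ y ∈ N, ‖y‖ = 1) ∧ N.card ≤ 5 ^ Module.finrank ℝ E ∧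
      ∀ x : E, ‖x‖ = 1 → ∃ y ∈ N, ‖x - y‖ ≤ 1 / 2 := by
  classical
  let p : Finset E → Prop := fun N =>
    (∀ y ∈ N, ‖y‖ = 1) ∧ ∀ y ∈ N, ∀ z ∈ N, y ≠ z → 1 / 2 ≤ ‖y - z‖
  have hcard : ∀ N, p N → N.card ≤ 5 ^ Module.finrank ℝ E := fun N hN => by
    -- Doubling turns `1/2`-separated unit vectors into `1`-separated points of the ball of radius
    -- `2`, the normalisation of the packing bound.
    rw [← Finset.card_image_of_injective N (smul_right_injective E (two_ne_zero (α := ℝ)))]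
    refine Besicovitch.card_le_of_separated _ ?_ ?_
    · simp only [Finset.mem_image, forall_exists_index, and_imp, forall_apply_eq_imp_iff₂]
      intro y hy
      rw [norm_smul, hN.1 y hy]; norm_num
    · simp only [Finset.mem_image, forall_exists_index, and_imp, forall_apply_eq_imp_iff₂]
      intro y hy z hz hyz
      rw [← smul_sub, norm_smul, Real.norm_two]
      have := hN.2 y hy z hz fun h => hyz (by rw [h])
      linarith
  -- A separated set of maximal cardinality is a net: a point far from it could be added.
  have hne : {c | ∃ N, p N ∧ N.card = c}.Nonempty := ⟨0, ∅, by simp [p], by simp⟩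
  have hbdd : BddAbove {c | ∃ N, p N ∧ N.card = c} :=
    ⟨5 ^ Module.finrank ℝ E, by rintro _ ⟨N, hN, rfl⟩; exact hcard N hN⟩
  obtain ⟨N, hN, hmax⟩ := Nat.sSup_mem hne hbdd
  refine ⟨N, hN.1, hcard N hN, fun x hx => ?_⟩
  by_contra! hfar
  have hxN : x ∉ N := fun h => by have := hfar x h; norm_num at this
  have hp : p (insert x N) := by
    refine ⟨?_, ?_⟩
    · intro y hy
      rcases Finset.mem_insert.1 hy with rfl | hy
      exacts [hx, hN.1 y hy]
    · intro y hy z hz hyz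
      rcases Finset.mem_insert.1 hy with rfl | hy' <;> rcases Finset.mem_insert.1 hz with rfl | hz'
      · exact absurd rfl hyz
      · exact (hfar z hz').le
      · rw [norm_sub_rev]; exact (hfar y hy').le
      · exact hN.2 y hy' z hz' hyz
  have := le_csSup hbdd ⟨insert x N, hp, rfl⟩
  rw [Finset.card_insert_of_notMem hxN, ← hmax] at this
  omega


/-- An isotropic vector of a positive semidefinite form lies in its radical: the form along `x + s •
y` is nonnegative for all `s`, which kills the mixed term. -/
theorem LinearMap.IsSymmetric.inner_eq_of_nonneg_of_eq_zero {E : Type*} [NormedAddCommGroup E]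
    [InnerProductSpace ℝ E] {T : E →ₗ[ℝ] E} (hT : T.IsSymmetric) (hpos : ∀ z, 0 ≤ ⟪T z, z⟫_ℝ)
    {x : E} (hx : ⟪T x, x⟫_ℝ = 0) (y : E) : ⟪T (y - x), y - x⟫_ℝ = ⟪T y, y⟫_ℝ := by
  have hsym : ∀ z, ⟪T z, x⟫_ℝ = ⟪T x, z⟫_ℝ := fun z => by rw [hT z x, real_inner_comm]
  have key : ⟪T x, y⟫_ℝ = 0 := by
    by_contra hne
    have h : ∀ s : ℝ, 0 ≤ ⟪T y, y⟫_ℝ * (s * s) + 2 * ⟪T x, y⟫_ℝ * s + 0 := fun s => by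
      have := hpos (x + s • y)
      simp only [map_add, map_smul, inner_add_left, inner_add_right, real_inner_smul_left,
        real_inner_smul_right, hx, hsym] at this
      linarith
    have hd := discrim_le_zero h
    rw [discrim] at hd
    have : 0 < ⟪T x, y⟫_ℝ ^ 2 := by positivity
    nlinarith
  simp only [map_sub, inner_sub_left, inner_sub_right, hx, hsym, key]
  ring

/-- A bound for a quadratic form on a `1/2`-net of the sphere gives twice the bound everywhere. -/
theorem LinearMap.IsSymmetric.abs_inner_le_of_half_net {E : Type*} [NormedAddCommGroup E]
    [InnerProductSpace ℝ E] [FiniteDimensional ℝ E] {T : E →ₗ[ℝ] E} (hT : T.IsSymmetric)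
    {N : Set E} (hN1 : ∀ y ∈ N, ‖y‖ = 1) (hN : ∀ x : E, ‖x‖ = 1 → ∃ y ∈ N, ‖x - y‖ ≤ 1 / 2)
    {t : ℝ} (ht : ∀ y ∈ N, |⟪T y, y⟫_ℝ| ≤ t) (x : E) : |⟪T x, x⟫_ℝ| ≤ 2 * t * ‖x‖ ^ 2 := by
  rcases subsingleton_or_nontrivial E with hE | hE
  · rw [Subsingleton.elim x 0]; simp
  have hcont : Continuous fun z => |⟪T z, z⟫_ℝ| :=
    ((T.continuous_of_finiteDimensional).inner continuous_id).abs
  obtain ⟨x₀, hx₀, hmax⟩ := (isCompact_sphere (0 : E) 1).exists_isMaxOn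
    (NormedSpace.sphere_nonempty.2 zero_le_one) hcont.continuousOn
  rw [mem_sphere_zero_iff_norm] at hx₀
  set c := |⟪T x₀, x₀⟫_ℝ| with hc
  have hle : ∀ z, |⟪T z, z⟫_ℝ| ≤ c * ‖z‖ ^ 2 := fun z => by
    rcases eq_or_ne z 0 with rfl | hz
    · simp
    have hz' : 0 < ‖z‖ := norm_pos_iff.2 hz
    have h := hmax (show ‖z‖⁻¹ • z ∈ Metric.sphere (0 : E) 1 by
      rw [mem_sphere_zero_iff_norm, norm_smul, norm_inv, norm_norm, inv_mul_cancel₀ hz'.ne'])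
    simp only [Set.mem_ofPred_eq, map_smul, real_inner_smul_left, real_inner_smul_right, abs_mul,
      abs_inv, abs_norm] at h
    rw [← mul_assoc, ← mul_inv, inv_mul_le_iff₀ (by positivity)] at h
    rw [pow_two]; linarith
  suffices h : c ≤ 2 * t from (hle x).trans (mul_le_mul_of_nonneg_right h (sq_nonneg _))
  obtain ⟨y, hy, hxy⟩ := hN x₀ hx₀
  obtain ⟨σ, hσ, hσc⟩ : ∃ σ : ℝ, |σ| = 1 ∧ σ * ⟪T x₀, x₀⟫_ℝ = c := by
    rcases abs_cases ⟪T x₀, x₀⟫_ℝ with h | h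
    · exact ⟨1, by simp, by rw [hc, h.1, one_mul]⟩
    · exact ⟨-1, by simp, by rw [hc, h.1, neg_one_mul]⟩
  -- `M` is positive semidefinite and isotropic at the maximiser `x₀`, so `⟪M y, y⟫ = ⟪M (y - x₀), y
  -- - x₀⟫ ≤ 2 * c * (1 / 4)`. The error is quadratic in the distance, which is why mesh `1/2`
  -- already gives the factor `2`.
  let M : E →ₗ[ℝ] E := c • LinearMap.id - σ • T
  have hM : ∀ z w, ⟪M z, w⟫_ℝ = c * ⟪z, w⟫_ℝ - σ * ⟪T z, w⟫_ℝ := fun z w => by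
    simp [M, inner_sub_left, real_inner_smul_left]
  have hMz : ∀ z, |σ * ⟪T z, z⟫_ℝ| ≤ c * ‖z‖ ^ 2 := fun z => by
    rw [abs_mul, hσ, one_mul]; exact hle z
  have hMs : M.IsSymmetric := fun z w => by
    rw [real_inner_comm (M w) z, hM, hM, hT z w, real_inner_comm w z, real_inner_comm (T w) z]
  have hMp : ∀ z, 0 ≤ ⟪M z, z⟫_ℝ := fun z => by
    rw [hM, real_inner_self_eq_norm_sq]
    linarith [(abs_le.1 (hMz z)).2]
  have hM0 : ⟪M x₀, x₀⟫_ℝ = 0 := by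
    rw [hM, real_inner_self_eq_norm_sq, hx₀, hσc]; ring
  have h := hMs.inner_eq_of_nonneg_of_eq_zero hMp hM0 y
  rw [hM, hM, real_inner_self_eq_norm_sq, real_inner_self_eq_norm_sq, hN1 y hy] at h
  have h1 := (abs_le.1 (hMz (y - x₀))).1
  have h2 : |σ * ⟪T y, y⟫_ℝ| ≤ t := by rw [abs_mul, hσ, one_mul]; exact ht y hy
  have h3 := (abs_le.1 h2).2
  have h4 : ‖y - x₀‖ ^ 2 ≤ 1 / 4 := by
    rw [norm_sub_rev]; nlinarith [norm_nonneg (x₀ - y)]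
  have h5 : 0 ≤ c := abs_nonneg _
  nlinarith

/-! ### Moments and moment generating function of a centred squared Gaussian. -/

/-- The logarithm of the left side is `u ^ 2 + 4 / 3 * u ^ 3 + ⋯`; for `|u| ≤ 1 / 12` the constant
`3 / 2` absorbs the higher terms. -/
theorem exp_neg_div_sqrt_one_sub_le {u : ℝ} (hu : |u| ≤ 1 / 12) :
    Real.exp (-u) / √(1 - 2 * u) ≤ Real.exp (3 / 2 * u ^ 2) := by
  obtain ⟨h1, h2⟩ := abs_le.1 hu
  have hpos : 0 < 1 - 2 * u := by linarith
  -- The claim squared. The exponential `exp w` is bounded below by `1 + w + w ^ 2 / 2` for `u ≥ 0`,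
  -- and by `(1 + w / 2) ^ 2` for `u ≤ 0`.
  have key : 1 ≤ (1 - 2 * u) * Real.exp (2 * u + 3 * u ^ 2) := by
    rcases le_total 0 u with h | h
    · have := Real.quadratic_le_exp_of_nonneg (x := 2 * u + 3 * u ^ 2) (by positivity)
      refine le_trans ?_ (mul_le_mul_of_nonneg_left this hpos.le)
      nlinarith [mul_nonneg (sq_nonneg u) h, sq_nonneg u, mul_nonneg (sq_nonneg u) (by linarith : 0 ≤ 1 / 12 - u),
        mul_nonneg (mul_nonneg (sq_nonneg u) (sq_nonneg u)) (by linarith : 0 ≤ 1 / 12 - u), mul_nonneg (sq_nonneg u) (sq_nonneg u)]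
    · have h3 := Real.add_one_le_exp (u + 3 / 2 * u ^ 2)
      have h4 : (u + 3 / 2 * u ^ 2 + 1) ^ 2 ≤ Real.exp (2 * u + 3 * u ^ 2) := by
        rw [show 2 * u + 3 * u ^ 2 = (u + 3 / 2 * u ^ 2) + (u + 3 / 2 * u ^ 2) by ring, Real.exp_add,
          ← pow_two]
        exact pow_le_pow_left₀ (by nlinarith) h3 2
      refine le_trans ?_ (mul_le_mul_of_nonneg_left h4 hpos.le)
      have h5 : 0 ≤ -u * u ^ 2 := mul_nonneg (by linarith) (sq_nonneg u)
      have h6 : 0 ≤ (-u * u ^ 2) * (u + 1 / 12) := mul_nonneg h5 (by linarith)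
      have h7 : 0 ≤ (-u * u ^ 2) * u ^ 2 := mul_nonneg h5 (sq_nonneg u)
      nlinarith
  rw [div_le_iff₀ (Real.sqrt_pos.2 hpos)]
  refine (abs_le_of_sq_le_sq ?_ (by positivity)).trans' (le_abs_self _)
  rw [mul_pow, Real.sq_sqrt hpos.le, ← Real.exp_nat_mul, ← Real.exp_nat_mul]
  calc Real.exp ((2 : ℕ) * -u) = 1 * Real.exp (-(2 * u)) := by push_cast; ring_nf
    _ ≤ (1 - 2 * u) * Real.exp (2 * u + 3 * u ^ 2) * Real.exp (-(2 * u)) :=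
      mul_le_mul_of_nonneg_right key (Real.exp_pos _).le
    _ = Real.exp ((2 : ℕ) * (3 / 2 * u ^ 2)) * (1 - 2 * u) := by
      rw [mul_assoc, ← Real.exp_add, mul_comm]; push_cast; ring_nf

theorem integral_pow_four_gaussianReal (v : ℝ≥0) :
    ∫ x, x ^ 4 ∂gaussianReal 0 v = 3 * (v : ℝ) ^ 2 := by
  have h1 : ∫ x, x ^ 4 ∂gaussianReal 0 1 = 3 := by
    rw [integral_gaussianReal_eq_integral_smul one_ne_zero]
    have hI : ∫ x : ℝ in Set.Ioi 0, x ^ 4 * Real.exp (-(1 / 2) * x ^ 2) = 3 / 2 * √(2 * Real.pi) := by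
      have h := integral_rpow_mul_exp_neg_mul_rpow (p := 2) (q := 4) (b := 1 / 2) (by norm_num)
        (by norm_num) (by norm_num)
      have hG : Real.Gamma (5 / 2) = 3 / 4 * √Real.pi := by
        rw [show (5 / 2 : ℝ) = 3 / 2 + 1 by norm_num, Real.Gamma_add_one (by norm_num),
          show (3 / 2 : ℝ) = 1 / 2 + 1 by norm_num, Real.Gamma_add_one (by norm_num),
          Real.Gamma_one_half_eq]
        ring
      have hb : (1 / 2 : ℝ) ^ (-(5 / 2) : ℝ) = 4 * √2 := by
        rw [one_div, Real.inv_rpow (by norm_num), Real.rpow_neg (by norm_num), inv_inv,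
          show (5 / 2 : ℝ) = 2 + 1 / 2 by norm_num, Real.rpow_add (by norm_num), Real.sqrt_eq_rpow]
        norm_num
      rw [show -(4 + 1 : ℝ) / 2 = -(5 / 2) by norm_num, show (4 + 1 : ℝ) / 2 = 5 / 2 by norm_num,
        hG, hb] at h
      rw [Real.sqrt_mul (by norm_num), show 3 / 2 * (√2 * √Real.pi)
        = 4 * √2 * (1 / 2) * (3 / 4 * √Real.pi) by ring, ← h]
      norm_cast
    have he : ∀ x : ℝ, gaussianPDFReal 0 1 x • x ^ 4
        = (√(2 * Real.pi))⁻¹ * (|x| ^ 4 * Real.exp (-(1 / 2) * |x| ^ 2)) := fun x => by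
      rw [gaussianPDFReal_def, smul_eq_mul, sq_abs, show |x| ^ 4 = x ^ 4 from Even.pow_abs (by decide) x]
      simp only [NNReal.coe_one, mul_one, sub_zero]
      rw [show -x ^ 2 / 2 = -(1 / 2) * x ^ 2 by ring]; ring
    simp only [he]
    rw [integral_const_mul, integral_comp_abs (f := fun x => x ^ 4 * Real.exp (-(1 / 2) * x ^ 2)), hI]
    have : √(2 * Real.pi) ≠ 0 := by positivity
    field_simp
  have hmap : gaussianReal 0 v = (gaussianReal 0 1).map (√(v : ℝ) * ·) := by
    rw [gaussianReal_map_const_mul]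
    congr 1
    · simp
    · ext; simp
  rw [hmap, integral_map (by fun_prop) (by fun_prop)]
  simp only [mul_pow]
  rw [integral_const_mul, h1, show √(v : ℝ) ^ 4 = (√(v : ℝ) ^ 2) ^ 2 by ring,
    Real.sq_sqrt v.coe_nonneg]
  ring

theorem integral_sq_gaussianReal (v : ℝ≥0) : ∫ x, x ^ 2 ∂gaussianReal 0 v = v := by
  have h := variance_fun_id_gaussianReal (μ := 0) (v := v)
  rw [variance_eq_integral (by fun_prop), integral_id_gaussianReal] at h
  simpa using h

theorem integrable_pow_gaussianReal (m : ℝ) (v : ℝ≥0) (p : ℕ) :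
    Integrable (fun x => x ^ p) (gaussianReal m v) := by
  rcases eq_or_ne p 0 with rfl | hp
  · simp
  · refine ((memLp_id_gaussianReal (μ := m) (v := v) p).integrable_norm_pow hp).mono' (by fun_prop) ?_
    filter_upwards with x
    simp

theorem integral_sq_sub_sq_gaussianReal (v : ℝ≥0) :
    ∫ x, (x ^ 2 - v) ^ 2 ∂gaussianReal 0 v = 2 * (v : ℝ) ^ 2 := by
  have e : ∀ x : ℝ, (x ^ 2 - v) ^ 2 = x ^ 4 - 2 * v * x ^ 2 + v ^ 2 := fun x => by ring
  simp only [e]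
  have h4 := integrable_pow_gaussianReal 0 v 4
  have h2 := (integrable_pow_gaussianReal 0 v 2).const_mul (2 * (v : ℝ))
  rw [integral_add (h4.sub' h2) (integrable_const _), integral_sub h4 h2,
    integral_const_mul, integral_pow_four_gaussianReal, integral_sq_gaussianReal]
  simp
  ring

theorem mgf_sq_sub_gaussianReal {v : ℝ≥0} (hv : v ≠ 0) {s : ℝ} (hs : 2 * (s * v) < 1) :
    mgf (fun x => x ^ 2 - (v : ℝ)) (gaussianReal 0 v) s
      = Real.exp (-(s * v)) / √(1 - 2 * (s * v)) := by
  have hv' : (0 : ℝ) < v := by positivity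
  rw [mgf, integral_gaussianReal_eq_integral_smul hv]
  have he : ∀ x : ℝ, gaussianPDFReal 0 v x • Real.exp (s * (x ^ 2 - v))
      = (√(2 * Real.pi * v))⁻¹ * Real.exp (-(s * v)) * Real.exp (-(1 / (2 * v) - s) * x ^ 2) := fun x => by
    rw [gaussianPDFReal_def, smul_eq_mul, mul_assoc, mul_assoc _ (Real.exp _) (Real.exp _), ← Real.exp_add,
      ← Real.exp_add]
    congr 2
    field_simp
    ring
  simp only [he]
  rw [integral_const_mul, integral_gaussian]
  have hb : Real.pi / (1 / (2 * v) - s) = (2 * Real.pi * v) / (1 - 2 * (s * v)) := by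
    have : 1 - 2 * (s * v) ≠ 0 := by linarith
    have h2 : (1 / (2 * v) - s : ℝ) = (1 - 2 * (s * v)) / (2 * v) := by field_simp
    rw [h2]; field_simp
  rw [hb, Real.sqrt_div (by positivity)]
  have : √(2 * Real.pi * v) ≠ 0 := by positivity
  field_simp

/-! ### The row vector `xᵀ S` and concentration of its squared norm. -/

section Column

variable {Ω : Type*} [MeasurableSpace Ω] {μ : Measure Ω} {n q : ℕ}
  {S : Ω → Matrix (Fin n) (Fin q) ℝ}

theorem IsScaledGaussianMatrix.hasLaw_entry (hS : IsScaledGaussianMatrix μ S) (i : Fin n)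
    (j : Fin q) : HasLaw (fun ω => S ω i j) (gaussianReal 0 (q : ℝ≥0)⁻¹) μ := by
  have h := hS.law i j
  rw [gaussianReal_map_div_const] at h
  convert h using 2
  · simp
  · ext; simp

/-- A linear image of independent Gaussians. Joint Gaussianity is what later upgrades uncorrelated
coordinates to independent ones. -/
theorem IsScaledGaussianMatrix.hasGaussianLaw_column (hS : IsScaledGaussianMatrix μ S)
    (x : Fin n → ℝ) : HasGaussianLaw (fun ω (j : Fin q) => ∑ i, x i * S ω i j) μ := by
  have h := iIndepFun.hasGaussianLaw (fun p : Fin n × Fin q => (hS.hasLaw_entry p.1 p.2).hasGaussianLaw) hS.indep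
  let L : (Fin n × Fin q → ℝ) →L[ℝ] (Fin q → ℝ) :=
    ContinuousLinearMap.pi fun j => ∑ i, x i • ContinuousLinearMap.proj (R := ℝ) (φ := fun _ => ℝ) (i, j)
  have hL : (fun ω (j : Fin q) => ∑ i, x i * S ω i j)
      = fun ω => L fun p : Fin n × Fin q => S ω p.1 p.2 := by
    ext ω j; simp [L]
  rw [hL]; exact h.map_fun L

theorem IsScaledGaussianMatrix.covariance_entry (hS : IsScaledGaussianMatrix μ S) (p r : Fin n × Fin q) :
    cov[fun ω => S ω p.1 p.2, fun ω => S ω r.1 r.2; μ] = if p = r then (q : ℝ)⁻¹ else 0 := by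
  have hp := hS.hasLaw_entry p.1 p.2
  have hr := hS.hasLaw_entry r.1 r.2
  have := hp.hasGaussianLaw.isProbabilityMeasure
  split_ifs with h
  · subst h
    rw [covariance_self hp.aemeasurable, hp.variance_eq, variance_id_gaussianReal]
    simp
  · exact (hS.indep.indepFun h).covariance_eq_zero hp.hasGaussianLaw.memLp_two
      hr.hasGaussianLaw.memLp_two

theorem IsScaledGaussianMatrix.covariance_column (hS : IsScaledGaussianMatrix μ S)
    (x : Fin n → ℝ) (j j' : Fin q) :
    cov[fun ω => ∑ i, x i * S ω i j, fun ω => ∑ i, x i * S ω i j'; μ]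
      = if j = j' then (∑ i, x i ^ 2) / q else 0 := by
  have hL : ∀ i j, MemLp (fun ω => x i * S ω i j) 2 μ := fun i j =>
    ((hS.hasLaw_entry i j).hasGaussianLaw.memLp_two).const_mul _
  rcases isEmpty_or_nonempty (Fin n) with hn | ⟨⟨i₀⟩⟩
  · simp [covariance]
  have := (hS.hasLaw_entry i₀ j).hasGaussianLaw.isProbabilityMeasure
  rw [covariance_fun_sum_fun_sum (fun i => hL i j) (fun i => hL i j')]
  have h : ∀ i i', cov[fun ω => x i * S ω i j, fun ω => x i' * S ω i' j'; μ]
      = if i = i' then (if j = j' then x i ^ 2 / q else 0) else 0 := fun i i' => by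
    rw [covariance_const_mul_left, covariance_const_mul_right, hS.covariance_entry (i, j) (i', j')]
    by_cases hi : i = i' <;> by_cases hj : j = j' <;> simp [hi, hj]
    field_simp
  simp only [h, Finset.sum_ite_eq, Finset.mem_univ, if_true]
  split_ifs
  · rw [Finset.sum_div]
  · simp

theorem IsScaledGaussianMatrix.iIndepFun_column (hS : IsScaledGaussianMatrix μ S)
    (x : Fin n → ℝ) : iIndepFun (fun (j : Fin q) ω => ∑ i, x i * S ω i j) μ :=
  (hS.hasGaussianLaw_column x).iIndepFun_of_covariance_eq_zero fun j j' h => by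
    rw [hS.covariance_column, if_neg h]

theorem IsScaledGaussianMatrix.hasLaw_column (hS : IsScaledGaussianMatrix μ S)
    (x : Fin n → ℝ) {v : ℝ≥0} (hv : (v : ℝ) = (∑ i, x i ^ 2) / q) (j : Fin q) :
    HasLaw (fun ω => ∑ i, x i * S ω i j) (gaussianReal 0 v) μ := by
  have h := (hS.hasGaussianLaw_column x).eval j
  refine ⟨h.aemeasurable, ?_⟩
  have := h.isProbabilityMeasure
  rw [h.map_eq_gaussianReal, ← covariance_self h.aemeasurable, hS.covariance_column, if_pos rfl,
    ← hv, Real.toNNReal_coe]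
  congr 1
  have hi : ∀ i, Integrable (fun ω => S ω i j) μ := fun i =>
    (hS.hasLaw_entry i j).hasGaussianLaw.integrable
  rw [integral_finsetSum _ fun i _ => (hi i).const_mul _]
  refine Finset.sum_eq_zero fun i _ => ?_
  rw [integral_const_mul, (hS.hasLaw_entry i j).integral_eq, integral_id_gaussianReal, mul_zero]

/-- The error made by the sketch on the squared norm of `x`. -/
noncomputable def sketchError (x : Fin n → ℝ) (M : Matrix (Fin n) (Fin q) ℝ) : ℝ :=
  ∑ j, ((∑ i, x i * M i j) ^ 2 - (∑ i, x i ^ 2) / q)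

theorem IsScaledGaussianMatrix.iIndepFun_sq_column (hS : IsScaledGaussianMatrix μ S)
    (x : Fin n → ℝ) (v : ℝ) :
    iIndepFun (fun (j : Fin q) ω => (∑ i, x i * S ω i j) ^ 2 - v) μ :=
  (hS.iIndepFun_column x).comp (fun _ y => y ^ 2 - v) fun _ => by fun_prop

theorem IsScaledGaussianMatrix.memLp_sketchError (hS : IsScaledGaussianMatrix μ S)
    (x : Fin n → ℝ) (j : Fin q) :
    MemLp (fun ω => (∑ i, x i * S ω i j) ^ 2 - (∑ i, x i ^ 2) / q) 2 μ := by
  lift (∑ i, x i ^ 2) / (q : ℝ) to ℝ≥0 using by positivity with v hv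
  have hl := hS.hasLaw_column x hv j
  have hf : MemLp (fun y : ℝ => y ^ 2 - (v : ℝ)) 2 (gaussianReal 0 v) := by
    rw [memLp_two_iff_integrable_sq (by fun_prop)]
    have e : ∀ x : ℝ, (x ^ 2 - v) ^ 2 = x ^ 4 - 2 * v * x ^ 2 + v ^ 2 := fun x => by ring
    simp only [e]
    exact ((integrable_pow_gaussianReal 0 v 4).sub'
      ((integrable_pow_gaussianReal 0 v 2).const_mul _)).add (integrable_const _)
  rw [← hl.map_eq] at hf
  exact (memLp_map_measure_iff hf.1 hl.aemeasurable).1 hf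

theorem IsScaledGaussianMatrix.memLp_two_sketchError (hS : IsScaledGaussianMatrix μ S)
    (x : Fin n → ℝ) : MemLp (fun ω => sketchError x (S ω)) 2 μ :=
  memLp_finsetSum _ fun j _ => hS.memLp_sketchError x j

/-- A sum of `q` independent centred variables `g ^ 2 - v` with `v = |x| ^ 2 / q`, each of variance
`2 * v ^ 2`. -/
theorem IsScaledGaussianMatrix.integral_sketchError_sq [IsProbabilityMeasure μ]
    (hS : IsScaledGaussianMatrix μ S) (x : Fin n → ℝ) :
    ∫ ω, sketchError x (S ω) ^ 2 ∂μ = 2 * (∑ i, x i ^ 2) ^ 2 / q := by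
  obtain ⟨v, hv⟩ : ∃ v : ℝ≥0, (v : ℝ) = (∑ i, x i ^ 2) / q :=
    ⟨⟨(∑ i, x i ^ 2) / q, by positivity⟩, rfl⟩
  have hm := hS.memLp_sketchError x
  have h0 : ∀ j : Fin q, ∫ ω, ((∑ i, x i * S ω i j) ^ 2 - (∑ i, x i ^ 2) / q) ∂μ = 0 := fun j => by
    have := (hS.hasLaw_column x hv j).integral_comp (f := fun y => y ^ 2 - (v : ℝ)) (by fun_prop)
    rw [integral_sub (integrable_pow_gaussianReal 0 v 2) (integrable_const _),
      integral_sq_gaussianReal] at this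
    rw [← hv]
    simpa [Function.comp_def] using this
  have hvar : ∀ j : Fin q,
      Var[fun ω => (∑ i, x i * S ω i j) ^ 2 - (∑ i, x i ^ 2) / q; μ] = 2 * (v : ℝ) ^ 2 := fun j => by
    rw [variance_of_integral_eq_zero (hm j).1.aemeasurable (h0 j), ← hv,
      ← integral_sq_sub_sq_gaussianReal]
    exact (hS.hasLaw_column x hv j).integral_comp (f := fun y => (y ^ 2 - (v : ℝ)) ^ 2) (by fun_prop)
  have hsum := IndepFun.variance_sum (s := Finset.univ) (fun j _ => hm j)
    fun j _ j' _ h => (hS.iIndepFun_sq_column x ((∑ i, x i ^ 2) / q)).indepFun h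
  simp only [hvar, Finset.sum_const, Finset.card_univ, Fintype.card_fin, nsmul_eq_mul] at hsum
  rw [variance_of_integral_eq_zero] at hsum
  · simp only [Finset.sum_apply] at hsum
    simp only [sketchError]
    rw [hsum, hv]
    rcases eq_or_ne q 0 with rfl | hq
    · simp
    · field_simp
  · exact (memLp_finsetSum' _ fun j _ => hm j).1.aemeasurable
  · simp only [Finset.sum_apply]
    rw [integral_finsetSum _ fun j _ => (hm j).integrable (by norm_num)]
    simp [h0]

/-- Independence gives the `q`-th power of the one-column bound at `u = s / q`. Positivity is
recorded because it yields integrability of the exponential: `mgf` is `0` otherwise. -/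
theorem IsScaledGaussianMatrix.mgf_sketchError (hS : IsScaledGaussianMatrix μ S) (hq : 0 < q)
    {x : Fin n → ℝ} (hx : ∑ i, x i ^ 2 = 1) {s : ℝ} (hs : |s / q| ≤ 1 / 12) :
    0 < mgf (fun ω => sketchError x (S ω)) μ s ∧
      mgf (fun ω => sketchError x (S ω)) μ s ≤ Real.exp (3 / 2 * s ^ 2 / q) := by
  have hq' : (0 : ℝ) < q := by exact_mod_cast hq
  obtain ⟨v, hv⟩ : ∃ v : ℝ≥0, (v : ℝ) = (∑ i, x i ^ 2) / q :=
    ⟨⟨(∑ i, x i ^ 2) / q, by positivity⟩, rfl⟩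
  have hv1 : s * v = s / q := by rw [hv, hx]; ring
  have hv0 : v ≠ 0 := by
    rw [← NNReal.coe_ne_zero, hv, hx]; positivity
  have h1 : 0 < 1 - 2 * (s * v) := by rw [hv1]; linarith [(abs_le.1 hs).2]
  have h := (hS.iIndepFun_sq_column x v).mgf_sum₀ (t := s)
    (fun j => ((hS.hasLaw_column x hv j).aemeasurable.pow_const 2).sub_const _) Finset.univ
  have hj : ∀ j : Fin q, mgf (fun ω => (∑ i, x i * S ω i j) ^ 2 - (v : ℝ)) μ s
      = Real.exp (-(s * v)) / √(1 - 2 * (s * v)) := fun j => by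
    rw [← mgf_sq_sub_gaussianReal hv0 (by linarith)]
    exact (hS.hasLaw_column x hv j).integral_comp
      (f := fun y => Real.exp (s * (y ^ 2 - (v : ℝ)))) (by fun_prop)
  have hX : (fun ω => sketchError x (S ω))
      = ∑ j : Fin q, fun ω => (∑ i, x i * S ω i j) ^ 2 - (v : ℝ) := by
    ext ω; simp [sketchError, hv]
  rw [hX, h]
  simp only [hj, Finset.prod_const, Finset.card_univ, Fintype.card_fin]
  refine ⟨by have := Real.sqrt_pos.2 h1; positivity, ?_⟩
  refine (pow_le_pow_left₀ (by positivity) (exp_neg_div_sqrt_one_sub_le (by rwa [hv1])) q).trans ?_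
  rw [← Real.exp_nat_mul, hv1]
  refine le_of_eq (congrArg _ ?_)
  field_simp

/-- Chernoff at `s = ± q * t / 3`, which minimises `-|s| * t + 3 / 2 * s ^ 2 / q`; `t ≤ 1 / 4` keeps
`|s / q| ≤ 1 / 12`. -/
theorem IsScaledGaussianMatrix.measureReal_le_abs_sketchError [IsProbabilityMeasure μ]
    (hS : IsScaledGaussianMatrix μ S) (hq : 0 < q)
    {x : Fin n → ℝ} (hx : ∑ i, x i ^ 2 = 1) {t : ℝ} (ht0 : 0 ≤ t) (ht : t ≤ 1 / 4) :
    μ.real {ω | t ≤ |sketchError x (S ω)|} ≤ 2 * Real.exp (-(q * t ^ 2 / 6)) := by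
  have hq' : (0 : ℝ) < q := by exact_mod_cast hq
  have hint : ∀ s : ℝ, |s / q| ≤ 1 / 12 →
      Integrable (fun ω => Real.exp (s * sketchError x (S ω))) μ := fun s hs => by
    by_contra hni
    exact (hS.mgf_sketchError hq hx hs).1.ne' (mgf_undef hni)
  have hs1 : |q * t / 3 / q| ≤ 1 / 12 := by
    rw [show q * t / 3 / q = t / 3 by field_simp, abs_of_nonneg (by positivity)]; linarith
  have hs2 : |-(q * t / 3) / q| ≤ 1 / 12 := by rwa [neg_div, abs_neg]
  have hup := measure_ge_le_exp_mul_mgf t (by positivity : 0 ≤ q * t / 3) (hint _ hs1)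
  have hlo := measure_le_le_exp_mul_mgf (-t) (by
    have : 0 ≤ q * t / 3 := by positivity
    linarith : -(q * t / 3) ≤ 0) (hint _ hs2)
  have hsub : {ω | t ≤ |sketchError x (S ω)|}
      ⊆ {ω | t ≤ sketchError x (S ω)} ∪ {ω | sketchError x (S ω) ≤ -t} := fun ω hω => by
    rcases le_abs.1 (show t ≤ |sketchError x (S ω)| from hω) with h | h
    exacts [Or.inl h, Or.inr (show _ ≤ -t by linarith)]
  have e : ∀ s, s = q * t / 3 → Real.exp (-(s * t)) * Real.exp (3 / 2 * s ^ 2 / q)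
      = Real.exp (-(q * t ^ 2 / 6)) := fun s hs => by
    rw [← Real.exp_add, hs]; congr 1; field_simp; ring
  refine (measureReal_mono hsub).trans ((measureReal_union_le _ _).trans ?_)
  have h1 := hup.trans (mul_le_mul_of_nonneg_left (hS.mgf_sketchError hq hx hs1).2 (Real.exp_pos _).le)
  have h2 := hlo.trans (mul_le_mul_of_nonneg_left (hS.mgf_sketchError hq hx hs2).2 (Real.exp_pos _).le)
  rw [neg_mul, e _ rfl] at h1
  rw [neg_neg, neg_sq, mul_neg, e _ rfl] at h2
  linarith

end Column

/-! ### Diagonalisation, a numerical bound and the Gram error. -/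

theorem exists_orthogonal_transpose_mul_self_eq_diagonal {m n : Type*} [Fintype m] [Fintype n]
    [DecidableEq n] (A : Matrix m n ℝ) :
    ∃ (V : Matrix n n ℝ) (l : n → ℝ), Vᵀ * V = 1 ∧ V * Vᵀ = 1 ∧ (A * V)ᵀ * (A * V) = diagonal l := by
  have hA : (Aᵀ * A).IsHermitian := by
    simpa [conjTranspose_eq_transpose_of_trivial] using isHermitian_conjTranspose_mul_self A
  refine ⟨hA.eigenvectorUnitary, hA.eigenvalues, ?_, ?_, ?_⟩
  · simpa [star_eq_conjTranspose, conjTranspose_eq_transpose_of_trivial] using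
      Unitary.coe_star_mul_self hA.eigenvectorUnitary
  · simpa [star_eq_conjTranspose, conjTranspose_eq_transpose_of_trivial] using
      Unitary.coe_mul_star_self hA.eigenvectorUnitary
  · have h := hA.conjStarAlgAut_star_eigenvectorUnitary
    rw [Unitary.conjStarAlgAut_star_apply, star_eq_conjTranspose,
      conjTranspose_eq_transpose_of_trivial] at h
    rw [transpose_mul, Matrix.mul_assoc, ← Matrix.mul_assoc Aᵀ, ← Matrix.mul_assoc, h]
    rfl

/-- From `exp 3 ≥ 18` and `exp x ≥ 1 + x` comes `exp (3 / δ) ≥ 18 / δ`. Hence `5 * exp (-(3 / δ)) ≤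
5 * δ / 18 ≤ 1`, and its `k`-th power is no larger. -/
theorem five_pow_mul_two_mul_exp_le {k : ℕ} (hk : 1 ≤ k) {δ : ℝ} (hδ0 : 0 < δ) (hδ1 : δ < 1) :
    5 ^ k * (2 * Real.exp (-(3 * k / δ))) ≤ 5 / 9 * δ := by
  have h3 : 18 ≤ Real.exp 3 := by
    rw [show (3 : ℝ) = (3 : ℕ) * 1 by norm_num, Real.exp_nat_mul]
    have := Real.exp_one_gt_d9
    calc (18 : ℝ) ≤ 2.7 ^ 3 := by norm_num
      _ ≤ _ := pow_le_pow_left₀ (by norm_num) (by linarith) 3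
  have hx : 1 ≤ 1 / δ := by rw [le_div_iff₀ hδ0]; linarith
  have hbase : 18 * (1 / δ) ≤ Real.exp (3 / δ) := by
    rw [show 3 / δ = 3 + 3 * (1 / δ - 1) by ring, Real.exp_add]
    refine mul_le_mul h3 ?_ (by positivity) (by positivity)
    linarith [Real.add_one_le_exp (3 * (1 / δ - 1))]
  have hinv : Real.exp (-(3 / δ)) ≤ δ / 18 := by
    rw [Real.exp_neg, inv_le_comm₀ (Real.exp_pos _) (by positivity)]
    refine le_trans (le_of_eq ?_) hbase
    field_simp
  have hle1 : 5 * Real.exp (-(3 / δ)) ≤ 1 := by linarith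
  have hpow : 5 ^ k * (2 * Real.exp (-(3 * k / δ))) = 2 * (5 * Real.exp (-(3 / δ))) ^ k := by
    rw [mul_pow, ← Real.exp_nat_mul, show (k : ℝ) * -(3 / δ) = -(3 * k / δ) by ring]; ring
  rw [hpow]
  have := pow_le_of_le_one (by positivity) hle1 (by omega : k ≠ 0)
  linarith

theorem sketchError_eq_dotProduct {n q : ℕ} (hq : 0 < q) (x : Fin n → ℝ)
    (M : Matrix (Fin n) (Fin q) ℝ) : sketchError x M = x ⬝ᵥ (M * Mᵀ - 1) *ᵥ x := by
  have hq' : (q : ℝ) ≠ 0 := by exact_mod_cast hq.ne'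
  rw [sub_mulVec, one_mulVec, dotProduct_sub, ← mulVec_mulVec, dotProduct_mulVec, ← mulVec_transpose,
    sketchError, Finset.sum_sub_distrib]
  simp only [Finset.sum_const, Finset.card_univ, Fintype.card_fin, nsmul_eq_mul,
    mul_div_cancel₀ _ hq', dotProduct, mulVec, transpose_apply, pow_two, mul_comm (M _ _)]

/-- The error made by a sketch `M` on the Gram matrix of the columns of `U`. -/
def gramError {n q : ℕ} {κ : Type*} (U : Matrix (Fin n) κ ℝ) (M : Matrix (Fin n) (Fin q) ℝ) :
    Matrix κ κ ℝ :=
  Uᵀ * (M * Mᵀ - 1) * U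

theorem transpose_gramError {n q : ℕ} {κ : Type*} (U : Matrix (Fin n) κ ℝ)
    (M : Matrix (Fin n) (Fin q) ℝ) : (gramError U M)ᵀ = gramError U M := by
  simp [gramError, Matrix.mul_assoc]

theorem sketchError_mulVec {n q : ℕ} {κ : Type*} [Fintype κ] (hq : 0 < q) (U : Matrix (Fin n) κ ℝ)
    (z : κ → ℝ) (M : Matrix (Fin n) (Fin q) ℝ) :
    sketchError (U *ᵥ z) M = z ⬝ᵥ gramError U M *ᵥ z := by
  rw [sketchError_eq_dotProduct hq, gramError, dotProduct_comm, ← mulVec_mulVec, ← mulVec_mulVec,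
    dotProduct_mulVec z Uᵀ, vecMul_transpose, dotProduct_comm]

theorem sum_mulVec_sq_of_transpose_mul_self {m κ : Type*} [Fintype m] [Fintype κ] [DecidableEq κ]
    {U : Matrix m κ ℝ} (hU : Uᵀ * U = 1) (z : κ → ℝ) : ∑ i, (U *ᵥ z) i ^ 2 = ∑ a, z a ^ 2 := by
  have h : (U *ᵥ z) ⬝ᵥ (U *ᵥ z) = z ⬝ᵥ z := by
    rw [dotProduct_mulVec, vecMul_mulVec, hU, vecMul_one]
  simpa [dotProduct, pow_two] using h

/-! ### Probabilistic bounds for the Gram error and reduction of the sketch property to them. -/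

section

variable {Ω : Type*} [MeasurableSpace Ω] {μ : Measure Ω} [IsProbabilityMeasure μ] {n q : ℕ}
  {S : Ω → Matrix (Fin n) (Fin q) ℝ} {κ : Type*} [Fintype κ] [DecidableEq κ]

/-- On a fixed subspace, all squared norms are preserved simultaneously up to a factor `1 ± 2t`. -/
theorem IsScaledGaussianMatrix.measureReal_not_subspace_embedding
    (hS : IsScaledGaussianMatrix μ S) (hq : 0 < q) {U : Matrix (Fin n) κ ℝ} (hU : Uᵀ * U = 1)
    {t : ℝ} (ht0 : 0 ≤ t) (ht : t ≤ 1 / 4) :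
    μ.real {ω | ¬ ∀ z : κ → ℝ,
        |z ⬝ᵥ gramError U (S ω) *ᵥ z| ≤ 2 * t * ∑ a, z a ^ 2}
      ≤ 5 ^ Fintype.card κ * (2 * Real.exp (-(q * t ^ 2 / 6))) := by
  obtain ⟨N, hN1, hNc, hN⟩ := exists_half_net_sphere (EuclideanSpace ℝ κ)
  rw [finrank_euclideanSpace] at hNc
  have hsub : {ω | ¬ ∀ z : κ → ℝ,
        |z ⬝ᵥ gramError U (S ω) *ᵥ z| ≤ 2 * t * ∑ a, z a ^ 2}
      ⊆ ⋃ y ∈ N, {ω | t ≤ |sketchError (U *ᵥ y.ofLp) (S ω)|} := by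
    intro ω hω
    by_contra hbad
    simp only [Set.mem_iUnion, Set.mem_ofPred_eq, exists_prop, not_exists, not_and, not_le] at hbad
    refine hω fun z => ?_
    set W := gramError U (S ω) with hW
    have hWs : (Matrix.toEuclideanLin W).IsSymmetric := by
      rw [isSymmetric_toEuclideanLin_iff, IsHermitian, conjTranspose_eq_transpose_of_trivial,
        hW, transpose_gramError]
    have hin : ∀ y : EuclideanSpace ℝ κ, ⟪Matrix.toEuclideanLin W y, y⟫_ℝ
        = y.ofLp ⬝ᵥ W *ᵥ y.ofLp := fun y => by
      simp [EuclideanSpace.inner_eq_star_dotProduct]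
    have := hWs.abs_inner_le_of_half_net (N := N) hN1 hN (t := t) (fun y hy => by
      rw [hin, hW, ← sketchError_mulVec hq]; exact (hbad y hy).le) (WithLp.toLp 2 z)
    rw [hin, EuclideanSpace.norm_sq_eq] at this
    simpa using this
  refine (measureReal_mono hsub (measure_ne_top _ _)).trans ((measureReal_biUnion_finset_le N _).trans ?_)
  calc ∑ y ∈ N, μ.real {ω | t ≤ |sketchError (U *ᵥ y.ofLp) (S ω)|}
      ≤ ∑ y ∈ N, 2 * Real.exp (-(q * t ^ 2 / 6)) := by
        refine Finset.sum_le_sum fun y hy => hS.measureReal_le_abs_sketchError hq ?_ ht0 ht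
        rw [sum_mulVec_sq_of_transpose_mul_self hU]
        have := EuclideanSpace.norm_sq_eq y
        rw [hN1 y hy] at this
        simpa using this.symm
    _ ≤ _ := by
        rw [Finset.sum_const, nsmul_eq_mul]
        exact mul_le_mul_of_nonneg_right (by exact_mod_cast hNc) (by positivity)

/-- A diagonal entry is the sketch error of a unit vector. Off the diagonal, polarise with the sum
and difference of two columns of `V`: both have squared norm `2`, so their errors have second moment
`8 / q`, and `(r - s) ^ 2 ≤ 2 * r ^ 2 + 2 * s ^ 2` gives `2 / q` again. -/
theorem IsScaledGaussianMatrix.integral_entry_sq_le (hS : IsScaledGaussianMatrix μ S) (hq : 0 < q)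
    {V : Matrix (Fin n) κ ℝ} (hV : Vᵀ * V = 1) (a b : κ) :
    Integrable (fun ω => gramError V (S ω) a b ^ 2) μ ∧
      ∫ ω, gramError V (S ω) a b ^ 2 ∂μ ≤ 2 / q := by
  have hi : ∀ x, Integrable (fun ω => sketchError x (S ω) ^ 2) μ := fun x =>
    (hS.memLp_two_sketchError x).integrable_sq
  by_cases hab : a = b
  · subst hab
    have e : ∀ ω, gramError V (S ω) a a = sketchError (V *ᵥ Pi.single a 1) (S ω) :=
      fun ω => by rw [sketchError_mulVec hq]; simp
    simp only [e]
    refine ⟨hi _, le_of_eq ?_⟩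
    rw [hS.integral_sketchError_sq, sum_mulVec_sq_of_transpose_mul_self hV]
    simp [Pi.single_apply]
  · set x := V *ᵥ (Pi.single a 1 + Pi.single b 1) with hx
    set y := V *ᵥ (Pi.single a 1 - Pi.single b 1) with hy
    have e : ∀ ω, gramError V (S ω) a b
        = (sketchError x (S ω) - sketchError y (S ω)) / 4 := fun ω => by
      have hs : gramError V (S ω) b a = gramError V (S ω) a b := by
        rw [← transpose_apply (gramError V (S ω)), transpose_gramError]
      rw [hx, hy, sketchError_mulVec hq, sketchError_mulVec hq]
      simp [mulVec_add, mulVec_sub, add_dotProduct, sub_dotProduct, hs]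
      ring
    have hnx : ∑ i, x i ^ 2 = 2 := by
      rw [hx, sum_mulVec_sq_of_transpose_mul_self hV]
      simp [Pi.single_apply, add_sq, Finset.sum_add_distrib, Ne.symm hab]
      norm_num
    have hny : ∑ i, y i ^ 2 = 2 := by
      rw [hy, sum_mulVec_sq_of_transpose_mul_self hV]
      simp [Pi.single_apply, sub_sq, Finset.sum_add_distrib, Ne.symm hab]
      norm_num
    have hint : Integrable (fun ω => gramError V (S ω) a b ^ 2) μ := by
      simp only [e]
      simpa [div_eq_mul_inv] using (((hS.memLp_two_sketchError x).sub
        (hS.memLp_two_sketchError y)).mul_const (4 : ℝ)⁻¹).integrable_sq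
    refine ⟨hint, ?_⟩
    calc ∫ ω, gramError V (S ω) a b ^ 2 ∂μ
        ≤ ∫ ω, (1 / 8 * sketchError x (S ω) ^ 2 + 1 / 8 * sketchError y (S ω) ^ 2) ∂μ := by
          refine integral_mono hint (((hi x).const_mul _).add ((hi y).const_mul _)) fun ω => ?_
          simp only [e]
          nlinarith [sq_nonneg (sketchError x (S ω) + sketchError y (S ω))]
      _ = 2 / q := by
          rw [integral_add ((hi x).const_mul _) ((hi y).const_mul _), integral_const_mul,
            integral_const_mul, hS.integral_sketchError_sq, hS.integral_sketchError_sq, hnx, hny]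
          ring

end

/-- Sufficient conditions for a sketch to preserve projection costs, in terms of the error on the
Gram matrix of the right singular vectors. -/
theorem isPCPS_of_gramError {n q : ℕ} {ε : ℝ} (hε0 : 0 < ε) (hε1 : ε < 1)
    {A V : Matrix (Fin n) (Fin n) ℝ} {l : Fin n → ℝ} (hV : V * Vᵀ = 1)
    (hl : (A * V)ᵀ * (A * V) = diagonal l) {K : Finset (Fin n)}
    (hK : ∀ a ∈ K, ∀ b ∉ K, l b ≤ l a) {M : Matrix (Fin n) (Fin q) ℝ}
    (hhead : ∀ z : Fin n → ℝ,
      |∑ a ∈ K, ∑ b ∈ K, z a * gramError V M a b * z b| ≤ ε / 2 * ∑ a ∈ K, z a ^ 2)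
    (htail : 2 * (∑ a ∈ Kᶜ, l a) * (∑ a ∈ K, ∑ b ∈ Kᶜ, gramError V M a b ^ 2 * l b)
        + (∑ a ∈ Kᶜ, l a) * (∑ a ∈ Kᶜ, l a * gramError V M a a ^ 2)
        + K.card * (∑ a ∈ Kᶜ, ∑ b ∈ Kᶜ, l a * l b * gramError V M a b ^ 2)
      ≤ ε ^ 2 / 16 * (∑ a ∈ Kᶜ, l a) ^ 2) :
    IsPCPS ε 0 K.card A (A * M) := by
  refine ⟨hε0.le, hε1, le_rfl, fun P hPs hP hPk => ?_⟩
  have h := abs_trace_mul_mul_transpose_le hl (transpose_gramError V M) hK hPs hP.eq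
    (by rw [Matrix.trace_eq_rank_of_isIdempotentElem hP, hPk]) hε0 hhead htail
  have e1 : ∀ X : Matrix (Fin n) (Fin n) ℝ, V * (Vᵀ * X) = X := fun X => by
    rw [← Matrix.mul_assoc, hV, Matrix.one_mul]
  have e2 : (1 - P) * (A * V) * ((1 - P) * (A * V))ᵀ = ((1 - P) * A) * ((1 - P) * A)ᵀ := by
    simp only [transpose_mul, Matrix.mul_assoc, e1]
  have e3 : (1 - P) * (A * V) * gramError V M * ((1 - P) * (A * V))ᵀ
      = ((1 - P) * (A * M)) * ((1 - P) * (A * M))ᵀ - ((1 - P) * A) * ((1 - P) * A)ᵀ := by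
    rw [gramError]
    generalize 1 - P = Y
    simp only [transpose_mul, Matrix.mul_assoc, e1, Matrix.mul_sub, Matrix.sub_mul, Matrix.one_mul]
  have e4 : ∀ {d : ℕ} (X : Matrix (Fin n) (Fin d) ℝ), X - P * X = (1 - P) * X := fun X => by
    rw [Matrix.sub_mul, Matrix.one_mul]
  rw [e2, e3, trace_sub] at h
  simp only [e4, Matrix.frobenius_norm_sq_eq_trace]
  obtain ⟨h1, h2⟩ := abs_le.1 h
  constructor <;> linarith

section

variable {Ω : Type*} [MeasurableSpace Ω] {μ : Measure Ω} [IsProbabilityMeasure μ] {n q : ℕ}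
  {S : Ω → Matrix (Fin n) (Fin q) ℝ} {κ : Type*} [Fintype κ] [DecidableEq κ]

theorem IsScaledGaussianMatrix.integral_sum_mul_entry_sq_le (hS : IsScaledGaussianMatrix μ S)
    (hq : 0 < q) {V : Matrix (Fin n) κ ℝ} (hV : Vᵀ * V = 1) {σ : Type*} (s : Finset σ)
    (f g : σ → κ) {c : σ → ℝ} (hc : ∀ p, 0 ≤ c p) :
    Integrable (fun ω => ∑ p ∈ s, c p * gramError V (S ω) (f p) (g p) ^ 2) μ ∧
      ∫ ω, ∑ p ∈ s, c p * gramError V (S ω) (f p) (g p) ^ 2 ∂μ ≤ 2 / q * ∑ p ∈ s, c p := by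
  have hi : ∀ p ∈ s, Integrable (fun ω => c p * gramError V (S ω) (f p) (g p) ^ 2) μ := fun p _ =>
    (hS.integral_entry_sq_le hq hV (f p) (g p)).1.const_mul _
  refine ⟨integrable_finsetSum _ hi, ?_⟩
  rw [integral_finsetSum _ hi, Finset.mul_sum]
  refine Finset.sum_le_sum fun p _ => ?_
  rw [integral_const_mul, mul_comm (2 / (q : ℝ))]
  exact mul_le_mul_of_nonneg_left (hS.integral_entry_sq_le hq hV (f p) (g p)).2 (hc p)

/-- Markov's inequality for the three sums of squares that control the tail of the spectrum. -/
theorem IsScaledGaussianMatrix.measureReal_tail_le (hS : IsScaledGaussianMatrix μ S) (hq : 0 < q)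
    {V : Matrix (Fin n) κ ℝ} (hV : Vᵀ * V = 1) {l : κ → ℝ} (hl : ∀ a, 0 ≤ l a) (K : Finset κ)
    (hK : 1 ≤ K.card) {ε : ℝ} (hε : 0 < ε) :
    μ.real {ω | ¬ 2 * (∑ a ∈ Kᶜ, l a) * (∑ a ∈ K, ∑ b ∈ Kᶜ, gramError V (S ω) a b ^ 2 * l b)
        + (∑ a ∈ Kᶜ, l a) * (∑ a ∈ Kᶜ, l a * gramError V (S ω) a a ^ 2)
        + K.card * (∑ a ∈ Kᶜ, ∑ b ∈ Kᶜ, l a * l b * gramError V (S ω) a b ^ 2)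
      ≤ ε ^ 2 / 16 * (∑ a ∈ Kᶜ, l a) ^ 2} ≤ 128 * K.card / (q * ε ^ 2) := by
  have hq' : (0 : ℝ) < q := by exact_mod_cast hq
  have hk : (1 : ℝ) ≤ K.card := by exact_mod_cast hK
  set τ := ∑ a ∈ Kᶜ, l a with hτ
  have hτ0 : 0 ≤ τ := Finset.sum_nonneg fun a _ => hl a
  -- For `τ = 0` Markov's threshold would be zero, but then all three terms vanish and the bad event
  -- is empty.
  rcases hτ0.eq_or_lt with h0 | h0
  · have hl0 : ∀ b ∈ Kᶜ, l b = 0 :=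
      (Finset.sum_eq_zero_iff_of_nonneg fun a _ => hl a).1 (hτ.symm.trans h0.symm)
    have hz : ∀ ω, ∑ a ∈ Kᶜ, ∑ b ∈ Kᶜ, l a * l b * gramError V (S ω) a b ^ 2 = 0 := fun ω =>
      Finset.sum_eq_zero fun a ha => Finset.sum_eq_zero fun b _ => by
        rw [hl0 a ha, zero_mul, zero_mul]
    simp only [hz, ← h0]
    simp
    positivity
  obtain ⟨i1, b1⟩ := hS.integral_sum_mul_entry_sq_le hq hV (K ×ˢ Kᶜ) Prod.fst Prod.snd
    (c := fun p => l p.2)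
    fun p => hl p.2
  obtain ⟨i2, b2⟩ := hS.integral_sum_mul_entry_sq_le hq hV Kᶜ id id hl
  obtain ⟨i3, b3⟩ := hS.integral_sum_mul_entry_sq_le hq hV (Kᶜ ×ˢ Kᶜ) Prod.fst Prod.snd
    (c := fun p => l p.1 * l p.2)
    fun p => mul_nonneg (hl p.1) (hl p.2)
  simp only [Finset.sum_product, id, Finset.sum_const, nsmul_eq_mul,
    ← Finset.sum_mul_sum] at i1 b1 i2 b2 i3 b3
  rw [← hτ] at b1 b2 b3
  set f : Ω → ℝ := fun ω =>
    2 * τ * (∑ a ∈ K, ∑ b ∈ Kᶜ, gramError V (S ω) a b ^ 2 * l b)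
        + τ * (∑ a ∈ Kᶜ, l a * gramError V (S ω) a a ^ 2)
        + K.card * (∑ a ∈ Kᶜ, ∑ b ∈ Kᶜ, l a * l b * gramError V (S ω) a b ^ 2) with hf
  have hf0 : ∀ ω, 0 ≤ f ω := fun ω => by
    have h1 : 0 ≤ ∑ a ∈ K, ∑ b ∈ Kᶜ, gramError V (S ω) a b ^ 2 * l b :=
      Finset.sum_nonneg fun a _ => Finset.sum_nonneg fun b _ => mul_nonneg (sq_nonneg _) (hl b)
    have h2 : 0 ≤ ∑ a ∈ Kᶜ, l a * gramError V (S ω) a a ^ 2 :=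
      Finset.sum_nonneg fun a _ => mul_nonneg (hl a) (sq_nonneg _)
    have h3 : 0 ≤ ∑ a ∈ Kᶜ, ∑ b ∈ Kᶜ, l a * l b * gramError V (S ω) a b ^ 2 :=
      Finset.sum_nonneg fun a _ => Finset.sum_nonneg fun b _ =>
        mul_nonneg (mul_nonneg (hl a) (hl b)) (sq_nonneg _)
    positivity
  simp only [mul_comm (l _) (_ ^ 2)] at i1 b1
  have i12 : Integrable (fun ω => 2 * τ * (∑ a ∈ K, ∑ b ∈ Kᶜ, gramError V (S ω) a b ^ 2 * l b)
      + τ * (∑ a ∈ Kᶜ, l a * gramError V (S ω) a a ^ 2)) μ :=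
    (i1.const_mul _).add (i2.const_mul _)
  have hfi : Integrable f μ := i12.add (i3.const_mul _)
  -- The three terms contribute `4 * k`, `2` and `2 * k` times `τ ^ 2 / q`, with `k = K.card`; `k ≥
  -- 1` bounds the total by `8 * k`.
  have hfb : ∫ ω, f ω ∂μ ≤ 8 * K.card * τ ^ 2 / q := by
    simp only [hf]
    rw [integral_add i12 (i3.const_mul _),
      integral_add (i1.const_mul _) (i2.const_mul _), integral_const_mul, integral_const_mul,
      integral_const_mul]
    have h1 := mul_le_mul_of_nonneg_left b1 (by positivity : 0 ≤ 2 * τ)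
    have h2 := mul_le_mul_of_nonneg_left b2 hτ0
    have h3 := mul_le_mul_of_nonneg_left b3 (by positivity : 0 ≤ (K.card : ℝ))
    have h4 : 2 / (q : ℝ) * τ ^ 2 * 1 ≤ 2 / (q : ℝ) * τ ^ 2 * K.card :=
      mul_le_mul_of_nonneg_left hk (by positivity)
    have e : 8 * K.card * τ ^ 2 / (q : ℝ) = 2 / (q : ℝ) * τ ^ 2 * K.card * 4 := by ring
    rw [e]
    linarith
  have hM := mul_meas_ge_le_integral_of_nonneg (Filter.Eventually.of_forall hf0) hfi
    (ε ^ 2 / 16 * τ ^ 2)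
  have hsub : {ω | ¬ f ω ≤ ε ^ 2 / 16 * τ ^ 2} ⊆ {ω | ε ^ 2 / 16 * τ ^ 2 ≤ f ω} :=
    fun ω hω => (not_le.1 hω).le
  refine (measureReal_mono hsub (measure_ne_top _ _)).trans ?_
  rw [← mul_le_mul_iff_right₀ (by positivity : 0 < ε ^ 2 / 16 * τ ^ 2)]
  refine hM.trans (hfb.trans (le_of_eq ?_))
  field_simp
  norm_num

end

/-! ### Choice of constants and union bound. -/

theorem lemma4p4 {Ω : Type*} [MeasurableSpace Ω] (μ : MeasureTheory.Measure Ω)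
    [MeasureTheory.IsProbabilityMeasure μ]
    (n q k : ℕ) (hk : 1 ≤ k) (ε δ : ℝ) (hε0 : 0 < ε) (hε1 : ε < 1) (hδ0 : 0 < δ) (hδ1 : δ < 1)
    (A : Matrix (Fin n) (Fin n) ℝ) (S : Ω → Matrix (Fin n) (Fin q) ℝ)
    (hS : IsScaledGaussianMatrix μ S)
    (hq : 288 * (k : ℝ) / (ε ^ 2 * δ) ≤ (q : ℝ)) :
    1 - δ ≤ μ.real {ω | IsPCPS ε 0 k A (A * S ω)} := by
  have hk' : (1 : ℝ) ≤ k := by exact_mod_cast hk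
  have hq' : (0 : ℝ) < q := lt_of_lt_of_le (by positivity) hq
  have hq0 : 0 < q := by exact_mod_cast hq'
  -- For `n < k` no `n × n` matrix has rank `k`, so the condition on `P` is vacuous.
  rcases lt_or_ge n k with hkn | hkn
  · have huniv : {ω | IsPCPS ε 0 k A (A * S ω)} = Set.univ := by
      refine Set.eq_univ_of_forall fun ω => ⟨hε0.le, hε1, le_rfl, fun P _ _ hP => ?_⟩
      have := P.rank_le_width
      omega
    rw [huniv, probReal_univ]
    linarith
  obtain ⟨V, l, hV1, hV2, hl⟩ := exists_orthogonal_transpose_mul_self_eq_diagonal A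
  obtain ⟨K, rfl, hK⟩ := exists_card_eq_forall_le l (k := k) (by simpa using hkn)
  have hl0 : ∀ a, 0 ≤ l a := fun a => by
    have := (A * V).transpose_mul_self_apply_self_nonneg a
    rwa [hl, diagonal_apply_eq] at this
  let U : Matrix (Fin n) K ℝ := V.submatrix id Subtype.val
  have hU : Uᵀ * U = 1 := by
    have : Uᵀ * U = (Vᵀ * V).submatrix Subtype.val Subtype.val := rfl
    rw [this, hV1, submatrix_one _ Subtype.val_injective]
  have hqε : 288 * (K.card : ℝ) / δ ≤ q * ε ^ 2 := by
    rw [div_le_iff₀ hδ0]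
    rw [div_le_iff₀ (by positivity)] at hq
    linarith
  -- The choice `t = ε / 4` makes the head bound `2 * t = ε / 2`.
  have hhead := hS.measureReal_not_subspace_embedding hq0 hU (t := ε / 4) (by linarith) (by linarith)
  have htail := hS.measureReal_tail_le hq0 hV1 hl0 K hk hε0
  set bad₁ := {ω | ¬ ∀ z : K → ℝ,
        |z ⬝ᵥ gramError U (S ω) *ᵥ z| ≤ 2 * (ε / 4) * ∑ a, z a ^ 2} with hbad₁
  set bad₂ := {ω | ¬ 2 * (∑ a ∈ Kᶜ, l a) * (∑ a ∈ K, ∑ b ∈ Kᶜ, gramError V (S ω) a b ^ 2 * l b)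
        + (∑ a ∈ Kᶜ, l a) * (∑ a ∈ Kᶜ, l a * gramError V (S ω) a a ^ 2)
        + K.card * (∑ a ∈ Kᶜ, ∑ b ∈ Kᶜ, l a * l b * gramError V (S ω) a b ^ 2)
      ≤ ε ^ 2 / 16 * (∑ a ∈ Kᶜ, l a) ^ 2} with hbad₂
  -- Covering the whole space needs only subadditivity, so no event has to be shown measurable.
  have hcover : Set.univ ⊆ {ω | IsPCPS ε 0 K.card A (A * S ω)} ∪ (bad₁ ∪ bad₂) := fun ω _ => by
    by_contra h
    simp only [Set.mem_union, not_or] at h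
    obtain ⟨h0, h1, h2⟩ := h
    refine h0 (isPCPS_of_gramError hε0 hε1 hV2 hl hK (fun z => ?_) (not_not.1 h2))
    have h := not_not.1 h1 fun a => z a
    have e1 : (fun a : K => z a) ⬝ᵥ gramError U (S ω) *ᵥ (fun a : K => z a)
        = ∑ a ∈ K, ∑ b ∈ K, z a * gramError V (S ω) a b * z b := by
      rw [← Finset.sum_coe_sort K]
      refine Finset.sum_congr rfl fun a _ => ?_
      rw [mulVec, dotProduct, Finset.mul_sum, ← Finset.sum_coe_sort K]
      exact Finset.sum_congr rfl fun b _ => (mul_assoc _ _ _).symm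
    rw [e1, Finset.sum_coe_sort K fun a => z a ^ 2] at h
    linarith
  have hone : 1 ≤ μ.real {ω | IsPCPS ε 0 K.card A (A * S ω)} + (μ.real bad₁ + μ.real bad₂) := by
    calc (1 : ℝ) = μ.real Set.univ := probReal_univ.symm
      _ ≤ _ := measureReal_mono hcover (measure_ne_top _ _)
      _ ≤ _ := measureReal_union_le _ _
      _ ≤ _ := by gcongr; exact measureReal_union_le _ _
  have hb1 : μ.real bad₁ ≤ 5 / 9 * δ := by
    refine hhead.trans (le_trans ?_ (five_pow_mul_two_mul_exp_le hk hδ0 hδ1))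
    -- The Chernoff exponent is `q * ε ^ 2 / 96`, and `288 / 96 = 3`.
    have he : 3 * (K.card : ℝ) / δ ≤ q * (ε / 4) ^ 2 / 6 := by
      calc 3 * (K.card : ℝ) / δ = 288 * (K.card : ℝ) / δ / 96 := by ring
        _ ≤ q * ε ^ 2 / 96 := by gcongr
        _ = q * (ε / 4) ^ 2 / 6 := by ring
    rw [Fintype.card_coe]
    exact mul_le_mul_of_nonneg_left (mul_le_mul_of_nonneg_left
      (Real.exp_le_exp.2 (neg_le_neg he)) zero_le_two) (by positivity)
  -- Markov gives the share `128 / 288 = 4 / 9` of `δ`.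
  have hb2 : μ.real bad₂ ≤ 4 / 9 * δ := by
    refine htail.trans ?_
    rw [div_le_iff₀ hδ0] at hqε
    rw [div_le_iff₀ (by positivity)]
    linarith
  linarith
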